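/- A permutation $\sigma$ is contained in a permutation $\pi$ if some (not necessarily consecutive) subsequence of $\pi$ is order isomorphic to $\sigma$; $\operatorname{Sub}(\pi)$ denotes the set of permutations contained in $\pi$, and a permutation class is a set of finite permutations closed downward under containment. The sum $\pi\oplus\sigma$ (respectively skew sum $\pi\ominus\sigma$) is obtained by placing a copy of $\sigma$ to the right of and above (respectively to the right of and below) a copy of $\pi$. For a class $\mathcal{C}$, let $\bigoplus\mathcal{C}$ (respectively $\bigominus\mathcal{C}$) be the smallest permutation class that contains $\mathcal{C}$ and is closed under $\oplus$ (respectively $\ominus$), and let $\operatorname{gr}(\mathcal{C})=\lim_{n\to\infty}\sqrt[n]{|\mathcal{C}_n|}$ when this limit exists, where $\mathcal{C}_n$ is the set of members of $\mathcal{C}$ of length $n$. For a real number $\gamma$ define \[ \mathcal{G}_\gamma=\Bigl\{\pi : \operatorname{gr}\bigl(\bigoplus\operatorname{Sub}(\pi)\bigr)<\gamma\ \text{ or }\ \operatorname{gr}\bigl(\bigominus\operatorname{Sub}(\pi)\bigr)<\gamma\Bigr\}. \] Let $\xi\approx 2.30522$ be the unique positive root of $x^5-2x^4-x^2-x-1$.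 Two axis-parallel rectangles are independent if their projections to the $x$-axis are disjoint and their projections to the $y$-axis are disjoint; a family of rectangles is independent if its members are pairwise independent. **Theorem.** The class $\mathcal{G}_\xi$ is concentrated: there are natural numbers $q$ and $r$ such that for every $\pi\in\mathcal{G}_\xi$ and every horizontal or vertical line $L$ that passes through no entry of the plot $\{(i,\pi(i))\}$ of $\pi$, all but at most $r$ of the entries of $\pi$ can be covered by $q$ independent axis-parallel rectangles which do not intersect $L$. -/

import Mathlib

open Filter Topology

noncomputable section

namespace PermClass

/-- A finite permutation together with its length. Positions and values are indexed from `0`,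
so that `⟨n, σ⟩` has one-line notation `σ 0 + 1, …, σ (n - 1) + 1`. -/
abbrev FinPerm : Type := Σ n : ℕ, Equiv.Perm (Fin n)

/-- `Contains π σ`: some subsequence of `π` is order isomorphic to `σ`. -/
def Contains (π σ : FinPerm) : Prop :=
  ∃ f : Fin σ.1 ↪o Fin π.1, ∀ i j, σ.2 i < σ.2 j ↔ π.2 (f i) < π.2 (f j)

/-- A permutation class: a set of permutations closed downward under containment. -/
def IsPermClass (C : Set FinPerm) : Prop :=
  ∀ π ∈ C, ∀ σ, Contains π σ → σ ∈ C

/-- `Sub π`, the set of permutations contained in `π`. -/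
def Sub (π : FinPerm) : Set FinPerm := {σ | Contains π σ}

/-- The sum `π ⊕ σ`: the entries of `σ` lie above and to the right of those of `π`. -/
def sum (π σ : FinPerm) : FinPerm :=
  ⟨π.1 + σ.1,
    (finSumFinEquiv.symm.trans (Equiv.sumCongr π.2 σ.2)).trans finSumFinEquiv⟩

/-- The skew sum `π ⊖ σ`: the entries of `σ` lie below and to the right of those of `π`. -/
def skewSum (π σ : FinPerm) : FinPerm :=
  ⟨π.1 + σ.1,
    (((finSumFinEquiv.symm.trans (Equiv.sumCongr π.2 σ.2)).trans (Equiv.sumComm _ _)).trans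
      finSumFinEquiv).trans (finCongr (Nat.add_comm σ.1 π.1))⟩

def IsSumClosed (C : Set FinPerm) : Prop := ∀ π ∈ C, ∀ σ ∈ C, sum π σ ∈ C

def IsSkewClosed (C : Set FinPerm) : Prop := ∀ π ∈ C, ∀ σ ∈ C, skewSum π σ ∈ C

/-- The sum closure: the smallest sum closed permutation class containing `C`. -/
def sumClosure (C : Set FinPerm) : Set FinPerm :=
  ⋂₀ {D | IsPermClass D ∧ IsSumClosed D ∧ C ⊆ D}

/-- The skew closure: the smallest skew closed permutation class containing `C`. -/
def skewClosure (C : Set FinPerm) : Set FinPerm :=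
  ⋂₀ {D | IsPermClass D ∧ IsSkewClosed D ∧ C ⊆ D}

/-- The number of permutations of length `n` in `C`. -/
def speed (C : Set FinPerm) (n : ℕ) : ℕ :=
  Nat.card {σ : Equiv.Perm (Fin n) // (⟨n, σ⟩ : FinPerm) ∈ C}

/-- The growth rate of `C`, i.e. the limit of the `n`-th roots of its speed, exists and is `g`. -/
def HasGrowthRate (C : Set FinPerm) (g : ℝ) : Prop :=
  Tendsto (fun n : ℕ => (speed C n : ℝ) ^ (1 / (n : ℝ))) atTop (𝓝 g)

/-- The cell class `G_γ`: the permutations `π` such that the sum closure or the skew closure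
of `Sub π` has growth rate less than `γ`. -/
def cellClass (γ : ℝ) : Set FinPerm :=
  {π | (∃ g < γ, HasGrowthRate (sumClosure (Sub π)) g) ∨
       (∃ g < γ, HasGrowthRate (skewClosure (Sub π)) g)}

/-- The point of the plot of `π` that corresponds to its `i`-th entry. -/
def point (π : FinPerm) (i : Fin π.1) : ℝ × ℝ := (((i : ℕ) : ℝ), ((π.2 i : ℕ) : ℝ))

/-- Horizontal and vertical lines in the plane. -/
def IsAxisLine (L : Set (ℝ × ℝ)) : Prop :=
  ∃ c : ℝ, L = {p | p.1 = c} ∨ L = {p | p.2 = c}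

/-- Axis-parallel rectangles in the plane. -/
def IsAxisRect (R : Set (ℝ × ℝ)) : Prop :=
  ∃ a b c d : ℝ, a < b ∧ c < d ∧ R = Set.Icc a b ×ˢ Set.Icc c d

/-- Two rectangles are independent if both their `x`- and their `y`-projections are disjoint. -/
def Independent (R S : Set (ℝ × ℝ)) : Prop :=
  Disjoint (Prod.fst '' R) (Prod.fst '' S) ∧ Disjoint (Prod.snd '' R) (Prod.snd '' S)

/-- `π` is `(q, r)`-concentrated: for every horizontal or vertical line `L` that passes through
no entry of `π`, all but at most `r` entries of `π` are covered by `q` pairwise independent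
axis-parallel rectangles that do not meet `L`. -/
def IsConcentratedPerm (q r : ℕ) (π : FinPerm) : Prop :=
  ∀ L : Set (ℝ × ℝ), IsAxisLine L → (∀ i, point π i ∉ L) →
    ∃ R : Fin q → Set (ℝ × ℝ),
      (∀ k, IsAxisRect (R k)) ∧
      Pairwise (fun k l => Independent (R k) (R l)) ∧
      (∀ k, Disjoint (R k) L) ∧
      {i : Fin π.1 | ∀ k, point π i ∉ R k}.ncard ≤ r

/-- A set of permutations is concentrated if, for some `q` and `r`, all of its members are
`(q, r)`-concentrated. -/
def IsConcentrated (X : Set FinPerm) : Prop :=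
  ∃ q r : ℕ, ∀ π ∈ X, IsConcentratedPerm q r π

theorem existsUnique_xi :
    ∃! x : ℝ, 0 < x ∧ x ^ 5 - 2 * x ^ 4 - x ^ 2 - x - 1 = 0 := by
  have hc : ContinuousOn (fun x : ℝ => x ^ 5 - 2 * x ^ 4 - x ^ 2 - x - 1) (Set.Icc 2 3) := by
    fun_prop
  obtain ⟨a, ha, ha0⟩ := intermediate_value_Icc (by norm_num : (2 : ℝ) ≤ 3) hc
    (show (0 : ℝ) ∈ Set.Icc _ _ by constructor <;> norm_num)
  have key : ∀ x y : ℝ, 0 < x → x < y → x ^ 5 - 2 * x ^ 4 - x ^ 2 - x - 1 = 0 →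
      y ^ 5 - 2 * y ^ 4 - y ^ 2 - y - 1 = 0 → False := by
    intro x y hx hxy h1 h2
    have hy : 0 < y := hx.trans hxy
    have hd : 0 < y - x := sub_pos.2 hxy
    have e : x ^ 5 * (y ^ 5 - 2 * y ^ 4 - y ^ 2 - y - 1)
        - y ^ 5 * (x ^ 5 - 2 * x ^ 4 - x ^ 2 - x - 1)
        = (y - x) * (2 * x ^ 4 * y ^ 4 + x ^ 2 * y ^ 2 * (x ^ 2 + x * y + y ^ 2)
          + x * y * (y ^ 3 + y ^ 2 * x + y * x ^ 2 + x ^ 3)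
          + (y ^ 4 + y ^ 3 * x + y ^ 2 * x ^ 2 + y * x ^ 3 + x ^ 4)) := by ring
    rw [h1, h2] at e
    have : 0 < (y - x) * (2 * x ^ 4 * y ^ 4 + x ^ 2 * y ^ 2 * (x ^ 2 + x * y + y ^ 2)
          + x * y * (y ^ 3 + y ^ 2 * x + y * x ^ 2 + x ^ 3)
          + (y ^ 4 + y ^ 3 * x + y ^ 2 * x ^ 2 + y * x ^ 3 + x ^ 4)) := by positivity
    linarith
  have ha' : 0 < a := by linarith [ha.1]
  refine ⟨a, ⟨ha', ha0⟩, ?_⟩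
  rintro b ⟨hb, hb0⟩
  rcases lt_trichotomy a b with h | h | h
  · exact (key a b ha' h ha0 hb0).elim
  · exact h.symm
  · exact (key b a hb h hb0 ha0).elim

/-- `ξ ≈ 2.30522`, the unique positive root of `x⁵ - 2x⁴ - x² - x - 1`. -/
def xi : ℝ := existsUnique_xi.choose

end PermClass

end

/-! ### Growth rates of sum closed sets of permutations -/

namespace PermClass

/-! The proof plays counting against geometry. In a sum closed set, a sum indecomposable first
component can be read off a permutation, so the speed satisfies a superadditive recurrence whose
coefficients count indecomposables. One indecomposable of length 1 and at least `n - 1` of each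
length `n` from 2 to 8 force growth rate at least `xi` (`xi_pow_le_speed`, `xi_le_growthRate`). Call
a point set with that many indecomposable patterns rich (`Rich`). If the sum closure of `Sub π`
grows more slowly than `xi`, the plot of `π` is not rich; in the skew case the same holds for its
reflection in a horizontal line.

It remains to cover a point set that is not rich. A vertical line has a set `L` of points to its
left; let `W` be the equally many lowest points. This gives four quadrants, and the upper left part
`A` and the lower right part `B` have the same size. If they are small they are discarded, and the
lower left part `C` and the upper right part `E` are already independent. If they are large, five
explicit configurations, each of which is rich, and the Erdős–Szekeres theorem show that almost
every point of `C` is either below and left of all of `A` and `B`, or to the right of `A` and above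
`B` (`Corner.card_mixed_le`). A half turn gives the same for `E`. The two pieces of `C`, the two of
`E`, and `A` and `B` are then six separated sets, none crossing the line (`coverable_of_not_rich`).
Horizontal lines follow by exchanging the coordinates, which preserves richness because inversion
preserves sum indecomposability. -/

/-- No proper nonempty initial segment of positions is mapped to an initial segment of values. -/
def SumIndec {n : ℕ} (σ : Equiv.Perm (Fin n)) : Prop :=
  ∀ k : ℕ, 0 < k → k < n → ∃ i j : Fin n, (i : ℕ) < k ∧ k ≤ (j : ℕ) ∧ σ j < σ i

theorem xi_pos : 0 < xi := existsUnique_xi.choose_spec.1.1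

theorem xi_root : xi ^ 5 - 2 * xi ^ 4 - xi ^ 2 - xi - 1 = 0 := existsUnique_xi.choose_spec.1.2

theorem one_lt_xi : 1 < xi := by
  have h0 := xi_pos
  have h := xi_root
  by_contra hle
  push Not at hle
  have h4 : 0 < xi ^ 4 := by positivity
  have : xi ^ 5 ≤ xi ^ 4 := by
    calc xi ^ 5 = xi ^ 4 * xi := by ring
      _ ≤ xi ^ 4 * 1 := by gcongr
      _ = xi ^ 4 := by ring
  nlinarith [sq_nonneg xi]

theorem xi_lt : xi < 231 / 100 := by
  have h0 := xi_pos
  have h := xi_root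
  by_contra hle
  push Not at hle
  have h1 : (231 / 100) ^ 2 ≤ xi ^ 2 := by gcongr
  have e : xi ^ 4 * (xi - 2) = xi ^ 2 + xi + 1 := by linarith
  have h2 : xi ^ 4 * (31 / 100) ≤ xi ^ 2 + xi + 1 := by
    rw [← e]; gcongr; linarith
  have h3 : (231 / 100) * xi ≤ xi ^ 2 := by nlinarith
  have h4 : (231 / 100) ^ 2 * xi ^ 2 ≤ xi ^ 4 := by nlinarith
  nlinarith

/-- The coefficients `1, 1, 2, …, 7` already give a growth rate of at least `xi`. -/
theorem xi_pow_eight_le :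
    xi ^ 8 ≤ xi ^ 7 + xi ^ 6 + 2 * xi ^ 5 + 3 * xi ^ 4 + 4 * xi ^ 3 + 5 * xi ^ 2 + 6 * xi + 7 := by
  have h0 := xi_pos
  have h := xi_root
  have h1 := xi_lt
  have e5 : xi ^ 5 = 2 * xi ^ 4 + xi ^ 2 + xi + 1 := by linarith
  have e6 : xi ^ 6 = 4 * xi ^ 4 + xi ^ 3 + 3 * xi ^ 2 + 3 * xi + 2 := by
    have : xi ^ 6 = xi * xi ^ 5 := by ring
    rw [this, e5]; linear_combination 2 * h
  have e7 : xi ^ 7 = 9 * xi ^ 4 + 3 * xi ^ 3 + 7 * xi ^ 2 + 6 * xi + 4 := by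
    have : xi ^ 7 = xi * xi ^ 6 := by ring
    rw [this, e6]; linear_combination 4 * h
  have e8 : xi ^ 8 = 21 * xi ^ 4 + 7 * xi ^ 3 + 15 * xi ^ 2 + 13 * xi + 9 := by
    have : xi ^ 8 = xi * xi ^ 7 := by ring
    rw [this, e7]; linear_combination 9 * h
  -- Modulo the quintic the claim becomes `xi ^ 4 ≤ xi ^ 3 + 2 * xi ^ 2 + 4 * xi + 6`, which holds
  -- because `xi < 2.31`.
  rw [e8, e7, e6, e5]
  have h2 : xi ^ 2 ≤ 231 / 100 * xi := by nlinarith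
  have h3 : xi ^ 4 ≤ (231 / 100) * xi ^ 3 := by
    have : 0 < xi ^ 3 := by positivity
    nlinarith
  have h4 : xi ^ 3 ≤ (231 / 100) * xi ^ 2 := by
    have : 0 < xi ^ 2 := by positivity
    nlinarith
  nlinarith

/-- One-line notation as a function on `ℕ`, extended by the identity. -/
def val (π : FinPerm) (i : ℕ) : ℕ := if h : i < π.1 then π.2 ⟨i, h⟩ else i

theorem val_lt {π : FinPerm} {i : ℕ} (h : i < π.1) : val π i < π.1 := by
  simp [val, h]

theorem finPerm_ext {π σ : FinPerm} (h : π.1 = σ.1) (hv : ∀ i < π.1, val π i = val σ i) :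
    π = σ := by
  obtain ⟨n, π⟩ := π
  obtain ⟨m, σ⟩ := σ
  obtain rfl : n = m := h
  congr
  ext i
  simpa [val] using hv i i.2

theorem val_sum_left {π σ : FinPerm} {i : ℕ} (h : i < π.1) : val (sum π σ) i = val π i := by
  have h' : i < (sum π σ).1 := Nat.lt_add_right _ h
  have e : (⟨i, h'⟩ : Fin (π.1 + σ.1)) = Fin.castAdd σ.1 ⟨i, h⟩ := rfl
  simp only [val, h, h', dif_pos]
  change ((((finSumFinEquiv.symm.trans (Equiv.sumCongr π.2 σ.2)).trans finSumFinEquiv)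
    (⟨i, h'⟩ : Fin (π.1 + σ.1)) : Fin (π.1 + σ.1)) : ℕ) = _
  rw [e]
  simp only [Equiv.trans_apply, finSumFinEquiv_symm_apply_castAdd, Equiv.sumCongr_apply,
    Sum.map_inl, finSumFinEquiv_apply_left, Fin.val_castAdd]

theorem val_sum_right {π σ : FinPerm} {i : ℕ} (h : i < σ.1) :
    val (sum π σ) (π.1 + i) = π.1 + val σ i := by
  have h' : π.1 + i < (sum π σ).1 := Nat.add_lt_add_left h _
  have e : (⟨π.1 + i, h'⟩ : Fin (π.1 + σ.1)) = Fin.natAdd π.1 ⟨i, h⟩ := rfl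
  simp only [val, h, h', dif_pos]
  change ((((finSumFinEquiv.symm.trans (Equiv.sumCongr π.2 σ.2)).trans finSumFinEquiv)
    (⟨π.1 + i, h'⟩ : Fin (π.1 + σ.1)) : Fin (π.1 + σ.1)) : ℕ) = _
  rw [e]
  simp only [Equiv.trans_apply, finSumFinEquiv_symm_apply_natAdd, Equiv.sumCongr_apply,
    Sum.map_inr, finSumFinEquiv_apply_right, Fin.val_natAdd]

/-- If `τ` were shorter than `τ'`, the cut after `τ` would split `τ'` into a lower left and an upper
right part. `SumIndec` holds vacuously in length 0, hence the positivity assumption on `τ`. -/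
theorem length_le_of_sum_eq {τ τ' ρ ρ' : FinPerm} (h0 : 0 < τ.1) (hi : SumIndec τ'.2)
    (h : sum τ ρ = sum τ' ρ') : τ'.1 ≤ τ.1 := by
  by_contra hlt
  push Not at hlt
  obtain ⟨i, j, hik, hkj, hji⟩ := hi τ.1 h0 hlt
  have e1 : val τ' i = val τ i := by
    rw [← val_sum_left (σ := ρ') i.2, ← h, val_sum_left hik]
  have hlen : τ.1 + ρ.1 = τ'.1 + ρ'.1 := congrArg Sigma.fst h
  have hj : (j : ℕ) = τ.1 + (j - τ.1) := by omega
  have hjr : (j : ℕ) - τ.1 < ρ.1 := by have := j.2; omega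
  have e2 : val τ' j = τ.1 + val ρ (j - τ.1) := by
    rw [← val_sum_left (σ := ρ') j.2, ← h, hj, val_sum_right hjr]
    simp
  have e3 := val_lt hik
  have e4 : val τ' j < val τ' i := by simpa [val] using hji
  omega

theorem sum_injective {τ τ' ρ ρ' : FinPerm} (h0 : 0 < τ.1) (h0' : 0 < τ'.1)
    (hi : SumIndec τ.2) (hi' : SumIndec τ'.2) (h : sum τ ρ = sum τ' ρ') : τ = τ' ∧ ρ = ρ' := by
  have hl : τ.1 = τ'.1 :=
    le_antisymm (length_le_of_sum_eq h0' hi h.symm) (length_le_of_sum_eq h0 hi' h)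
  have hlen : τ.1 + ρ.1 = τ'.1 + ρ'.1 := congrArg Sigma.fst h
  refine ⟨finPerm_ext hl fun i hi => ?_, finPerm_ext (by omega) fun i hi => ?_⟩
  · rw [← val_sum_left (σ := ρ) hi, h, val_sum_left (hl ▸ hi)]
  · have e1 := val_sum_right (π := τ) hi
    have e2 := val_sum_right (π := τ') (σ := ρ') (i := i) (by omega)
    rw [h, hl] at e1
    omega

open Classical in
/-- The members of length `n` of a set of permutations. -/
noncomputable def level (C : Set FinPerm) (n : ℕ) : Finset FinPerm :=
  (Finset.univ.filter fun σ : Equiv.Perm (Fin n) => (⟨n, σ⟩ : FinPerm) ∈ C).map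
    ⟨fun σ => ⟨n, σ⟩, fun _ _ h => eq_of_heq (Sigma.mk.inj h).2⟩

theorem mem_level {C : Set FinPerm} {n : ℕ} {π : FinPerm} :
    π ∈ level C n ↔ π ∈ C ∧ π.1 = n := by
  simp only [level, Finset.mem_map, Finset.mem_filter, Finset.mem_univ, true_and]
  constructor
  · rintro ⟨σ, h, rfl⟩
    exact ⟨h, rfl⟩
  · rintro ⟨h, rfl⟩
    exact ⟨π.2, h, rfl⟩

theorem card_level (C : Set FinPerm) (n : ℕ) : (level C n).card = speed C n := by
  classical
  rw [level, Finset.card_map, speed, Nat.card_eq_fintype_card, Fintype.card_subtype]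

/-- The sum indecomposable members of `C`. -/
def indecs (C : Set FinPerm) : Set FinPerm := {π | π ∈ C ∧ SumIndec π.2}

/-- Prefixing a nonempty sum indecomposable member to any member is injective, over all lengths of
the prefix at once. -/
theorem sum_mul_speed_le {C : Set FinPerm} (hC : IsSumClosed C) {n : ℕ} (s : Finset ℕ)
    (hs : ∀ j ∈ s, 0 < j ∧ j ≤ n) :
    ∑ j ∈ s, speed (indecs C) j * speed C (n - j) ≤ speed C n := by
  have e : ∑ j ∈ s, speed (indecs C) j * speed C (n - j) =
      (s.sigma fun j => level (indecs C) j ×ˢ level C (n - j)).card := by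
    simp [Finset.card_sigma, card_level]
  rw [e, ← card_level]
  refine Finset.card_le_card_of_injOn (fun t => sum t.2.1 t.2.2) ?_ ?_
  · rintro ⟨j, τ, ρ⟩ h
    simp only [Finset.coe_sigma, Set.mem_sigma_iff, Finset.mem_coe, Finset.mem_product,
      mem_level] at h ⊢
    obtain ⟨hj, ⟨hτ, e1⟩, hρ, e2⟩ := h
    refine ⟨hC _ hτ.1 _ hρ, ?_⟩
    have := hs j hj
    change τ.1 + ρ.1 = n
    omega
  · rintro ⟨j, τ, ρ⟩ h ⟨j', τ', ρ'⟩ h' heq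
    simp only [Finset.coe_sigma, Set.mem_sigma_iff, Finset.mem_coe, Finset.mem_product,
      mem_level] at h h'
    obtain ⟨hj, ⟨hτ, e1⟩, hρ, e2⟩ := h
    obtain ⟨hj', ⟨hτ', e1'⟩, hρ', e2'⟩ := h'
    have := hs j hj
    have := hs j' hj'
    obtain ⟨rfl, rfl⟩ := sum_injective (by omega) (by omega) hτ.2 hτ'.2 heq
    obtain rfl : j = j' := by omega
    rfl

theorem xi_pow_le_speed {C : Set FinPerm} (hC : IsSumClosed C) (h0 : 1 ≤ speed C 0)
    (h1 : 1 ≤ speed (indecs C) 1)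
    (hr : ∀ n, 2 ≤ n → n ≤ 8 → n - 1 ≤ speed (indecs C) n) (n : ℕ) :
    xi ^ n ≤ xi ^ 8 * speed C n := by
  have hx := one_lt_xi
  have h0' := xi_pos
  have hstep : ∀ n, speed C n ≤ speed C (n + 1) := by
    intro n
    have := sum_mul_speed_le hC (n := n + 1) {1} (by simp)
    simp only [Finset.sum_singleton, Nat.add_sub_cancel] at this
    nlinarith
  have hone : ∀ n, 1 ≤ speed C n := by
    intro n
    induction n with
    | zero => exact h0
    | succ n ih => exact ih.trans (hstep n)
  induction n using Nat.strong_induction_on with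
  | _ n ih =>
    -- The constant `xi ^ 8` absorbs the initial lengths, where only `1 ≤ speed C n` is known;
    -- beyond them the eight-term recurrence is available.
    rcases le_or_gt n 8 with hn | hn
    · calc xi ^ n ≤ xi ^ 8 := pow_le_pow_right₀ hx.le hn
        _ = xi ^ 8 * 1 := by ring
        _ ≤ xi ^ 8 * speed C n := by
          gcongr
          exact_mod_cast hone n
    · obtain ⟨m, rfl⟩ : ∃ m, n = m + 8 := ⟨n - 8, by omega⟩
      have key := sum_mul_speed_le hC (n := m + 8) (Finset.Icc 1 8) (by
        intro j hj
        rw [Finset.mem_Icc] at hj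
        omega)
      have t : Finset.Icc 1 8 = {1, 2, 3, 4, 5, 6, 7, 8} := by decide
      rw [t] at key
      simp only [Finset.mem_insert, Finset.mem_singleton, Finset.sum_insert,
        Finset.sum_singleton, OfNat.one_ne_ofNat, Nat.reduceEqDiff,
        or_self, not_false_eq_true, Nat.add_sub_cancel,
        show m + 8 - 1 = m + 7 from rfl, show m + 8 - 2 = m + 6 from rfl,
        show m + 8 - 3 = m + 5 from rfl, show m + 8 - 4 = m + 4 from rfl,
        show m + 8 - 5 = m + 3 from rfl, show m + 8 - 6 = m + 2 from rfl,
        show m + 8 - 7 = m + 1 from rfl] at key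
      have key2 : speed C (m + 7) + speed C (m + 6) + 2 * speed C (m + 5) + 3 * speed C (m + 4)
          + 4 * speed C (m + 3) + 5 * speed C (m + 2) + 6 * speed C (m + 1) + 7 * speed C m
          ≤ speed C (m + 8) := by
        have a1 := Nat.mul_le_mul_right (speed C (m + 7)) h1
        have a2 := Nat.mul_le_mul_right (speed C (m + 6)) (hr 2 (by norm_num) (by norm_num))
        have a3 := Nat.mul_le_mul_right (speed C (m + 5)) (hr 3 (by norm_num) (by norm_num))
        have a4 := Nat.mul_le_mul_right (speed C (m + 4)) (hr 4 (by norm_num) (by norm_num))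
        have a5 := Nat.mul_le_mul_right (speed C (m + 3)) (hr 5 (by norm_num) (by norm_num))
        have a6 := Nat.mul_le_mul_right (speed C (m + 2)) (hr 6 (by norm_num) (by norm_num))
        have a7 := Nat.mul_le_mul_right (speed C (m + 1)) (hr 7 (by norm_num) (by norm_num))
        have a8 := Nat.mul_le_mul_right (speed C m) (hr 8 (by norm_num) (by norm_num))
        simp only [Nat.reduceSub] at a1 a2 a3 a4 a5 a6 a7 a8
        linarith
      have key3 : (speed C (m + 7) : ℝ) + speed C (m + 6) + 2 * speed C (m + 5)
          + 3 * speed C (m + 4) + 4 * speed C (m + 3) + 5 * speed C (m + 2)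
          + 6 * speed C (m + 1) + 7 * speed C m ≤ speed C (m + 8) := by exact_mod_cast key2
      have i0 := ih m (by omega)
      have i1 := ih (m + 1) (by omega)
      have i2 := ih (m + 2) (by omega)
      have i3 := ih (m + 3) (by omega)
      have i4 := ih (m + 4) (by omega)
      have i5 := ih (m + 5) (by omega)
      have i6 := ih (m + 6) (by omega)
      have i7 := ih (m + 7) (by omega)
      have hm : 0 < xi ^ m := by positivity
      have h8 : 0 < xi ^ 8 := by positivity
      calc xi ^ (m + 8) = xi ^ m * xi ^ 8 := by ring
        _ ≤ xi ^ m * (xi ^ 7 + xi ^ 6 + 2 * xi ^ 5 + 3 * xi ^ 4 + 4 * xi ^ 3 + 5 * xi ^ 2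
            + 6 * xi + 7) := by
          gcongr
          exact xi_pow_eight_le
        _ = xi ^ (m + 7) + xi ^ (m + 6) + 2 * xi ^ (m + 5) + 3 * xi ^ (m + 4)
            + 4 * xi ^ (m + 3) + 5 * xi ^ (m + 2) + 6 * xi ^ (m + 1) + 7 * xi ^ m := by ring
        _ ≤ xi ^ 8 * (speed C (m + 7) + speed C (m + 6) + 2 * speed C (m + 5)
            + 3 * speed C (m + 4) + 4 * speed C (m + 3) + 5 * speed C (m + 2)
            + 6 * speed C (m + 1) + 7 * speed C m) := by linarith
        _ ≤ xi ^ 8 * speed C (m + 8) := by gcongr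

/-- The constant factor `xi ^ 8` tends to 1 under `n`-th roots. -/
theorem xi_le_growthRate {C : Set FinPerm} {g : ℝ} (hg : HasGrowthRate C g)
    (h : ∀ n, xi ^ n ≤ xi ^ 8 * speed C n) : xi ≤ g := by
  have h0 := xi_pos
  have hlim : Tendsto (fun n : ℕ => (xi ^ 8)⁻¹ ^ (1 / (n : ℝ)) * xi) atTop (𝓝 xi) := by
    have h1 : Tendsto (fun n : ℕ => 1 / (n : ℝ)) atTop (𝓝 0) := tendsto_one_div_atTop_nhds_zero_nat
    have h2 : Tendsto (fun n : ℕ => (xi ^ 8)⁻¹ ^ (1 / (n : ℝ))) atTop (𝓝 ((xi ^ 8)⁻¹ ^ (0 : ℝ))) :=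
      (tendsto_const_nhds (x := (xi ^ 8)⁻¹)).rpow h1 (Or.inl (by positivity))
    simpa using h2.mul_const xi
  refine le_of_tendsto_of_tendsto hlim hg ?_
  filter_upwards [eventually_gt_atTop 0] with n hn
  have h8 : 0 < xi ^ 8 := by positivity
  have hle : (xi ^ 8)⁻¹ * xi ^ n ≤ speed C n := by
    rw [inv_mul_le_iff₀ h8]
    exact h n
  calc (xi ^ 8)⁻¹ ^ (1 / (n : ℝ)) * xi
      = (xi ^ 8)⁻¹ ^ (1 / (n : ℝ)) * (xi ^ n) ^ (1 / (n : ℝ)) := by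
        rw [one_div, Real.pow_rpow_inv_natCast h0.le hn.ne']
    _ = ((xi ^ 8)⁻¹ * xi ^ n) ^ (1 / (n : ℝ)) := by
        rw [Real.mul_rpow (by positivity) (by positivity)]
    _ ≤ (speed C n : ℝ) ^ (1 / (n : ℝ)) := by
        gcongr

end PermClass

/-! ### Rich configurations of points -/

namespace PermClass

variable {α : Type*}

/-- The points `(x a, y a)` contain a copy of `σ`. -/
def HasPattern (x y : α → ℝ) {n : ℕ} (σ : Equiv.Perm (Fin n)) : Prop :=
  ∃ f : Fin n → α, StrictMono (x ∘ f) ∧ ∀ i j, σ i < σ j ↔ y (f i) < y (f j)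

/-- The points `(x a, y a)` contain many sum indecomposable patterns of each length from
`2` to `8`. -/
def Rich (x y : α → ℝ) : Prop :=
  ∀ n, 2 ≤ n → n ≤ 8 → n - 1 ≤ Nat.card {σ : Equiv.Perm (Fin n) // SumIndec σ ∧ HasPattern x y σ}

theorem SumIndec.inv {n : ℕ} {σ : Equiv.Perm (Fin n)} (h : SumIndec σ) : SumIndec σ⁻¹ := by
  intro k hk hkn
  by_contra hcon
  push Not at hcon
  obtain ⟨i, j, hi, hj, hij⟩ := h k hk hkn
  -- `σ⁻¹` maps the first `k` values below the others, hence to the first `k` positions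
  have hlow : ∀ a : Fin n, (a : ℕ) < k → ((σ⁻¹ a : Fin n) : ℕ) < k := by
    intro a ha
    by_contra hak
    push Not at hak
    have hsub : (Finset.univ.filter fun b : Fin n => k ≤ (b : ℕ)).image ⇑σ⁻¹ ⊆
        Finset.univ.filter fun b : Fin n => ((σ⁻¹ a : Fin n) : ℕ) < b := by
      intro c hc
      simp only [Finset.mem_image, Finset.mem_filter, Finset.mem_univ, true_and] at hc ⊢
      obtain ⟨b, hb, rfl⟩ := hc
      have h1 := hcon a b ha hb
      have h2 : σ⁻¹ a ≠ σ⁻¹ b := fun e => by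
        have := σ⁻¹.injective e
        subst this
        omega
      exact lt_of_le_of_ne h1 fun e => h2 (Fin.ext e)
    have hsub2 : (Finset.univ.filter fun b : Fin n => ((σ⁻¹ a : Fin n) : ℕ) < b) ⊂
        Finset.univ.filter fun b : Fin n => k ≤ (b : ℕ) := by
      rw [Finset.ssubset_iff_of_subset]
      · exact ⟨σ⁻¹ a, by simpa using hak, by simp⟩
      · intro c hc
        simp only [Finset.mem_filter, Finset.mem_univ, true_and] at hc ⊢
        omega
    have h1 := Finset.card_le_card hsub
    rw [Finset.card_image_of_injective _ σ⁻¹.injective] at h1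
    exact absurd (Finset.card_lt_card hsub2) (not_lt.2 h1)
  have himg : (Finset.univ.filter fun a : Fin n => (a : ℕ) < k).image ⇑σ⁻¹ =
      Finset.univ.filter fun a : Fin n => (a : ℕ) < k := by
    apply Finset.eq_of_subset_of_card_le
    · intro c hc
      simp only [Finset.mem_image, Finset.mem_filter, Finset.mem_univ, true_and] at hc ⊢
      obtain ⟨b, hb, rfl⟩ := hc
      exact hlow b hb
    · rw [Finset.card_image_of_injective _ σ⁻¹.injective]
  have hi' : (σ i : ℕ) < k := by
    have : i ∈ Finset.univ.filter fun a : Fin n => (a : ℕ) < k := by simpa using hi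
    rw [← himg, Finset.mem_image] at this
    obtain ⟨b, hb, e⟩ := this
    have : σ i = b := by rw [← e]; simp
    rw [this]
    simpa using hb
  have hj' : k ≤ (σ j : ℕ) := by
    by_contra hlt
    push Not at hlt
    have := hlow _ hlt
    simp at this
    omega
  have : (σ j : ℕ) < σ i := hij
  omega

/-- Exchanging coordinates inverts patterns. This reduces horizontal lines to vertical ones and
makes the roles of `A` and `B` below symmetric. -/
theorem Rich.transpose {x y : α → ℝ} (h : Rich y x) : Rich x y := by
  intro n h2 h8
  refine (h n h2 h8).trans ?_
  refine Nat.card_le_card_of_injective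
    (fun σ => ⟨σ.1⁻¹, σ.2.1.inv, ?_⟩) fun σ τ e => ?_
  · obtain ⟨f, hf, hσ⟩ := σ.2.2
    refine ⟨f ∘ ⇑σ.1⁻¹, fun i j hij => ?_, fun i j => ?_⟩
    · rw [Function.comp_apply, Function.comp_apply, Function.comp_apply, Function.comp_apply,
        ← hσ]
      simpa using hij
    · exact (hf.lt_iff_lt).symm
  · simpa [Subtype.ext_iff] using e

/-- A half turn reverses both positions and values of a pattern and keeps it sum indecomposable. It
carries results about the lower left quadrant to the upper right one. -/
theorem Rich.rotate {x y : α → ℝ} (h : Rich (fun a => -x a) (fun a => -y a)) : Rich x y := by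
  intro n h2 h8
  refine (h n h2 h8).trans ?_
  refine Nat.card_le_card_of_injective
    (fun σ => ⟨(Fin.revPerm.trans σ.1).trans Fin.revPerm, ?_, ?_⟩) fun σ τ e => ?_
  · intro k hk hkn
    obtain ⟨i, j, hi, hj, hij⟩ := σ.2.1 (n - k) (by omega) (by omega)
    refine ⟨j.rev, i.rev, ?_, ?_, ?_⟩
    · rw [Fin.val_rev]; omega
    · rw [Fin.val_rev]; omega
    · simpa using hij
  · obtain ⟨f, hf, hσ⟩ := σ.2.2
    refine ⟨f ∘ Fin.rev, fun i j hij => ?_, fun i j => ?_⟩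
    · have := hf (Fin.rev_lt_rev.2 hij)
      simpa using this
    · simpa using hσ j.rev i.rev
  · ext i
    have e' : (Fin.revPerm.trans σ.1).trans Fin.revPerm = (Fin.revPerm.trans τ.1).trans Fin.revPerm :=
      congrArg Subtype.val e
    have := DFunLike.congr_fun e' i.rev
    simp only [Equiv.trans_apply, Fin.revPerm_apply, Fin.rev_rev, Fin.rev_inj] at this
    rw [this]

theorem exists_pattern {n : ℕ} {h : Fin n → ℝ} (hh : Function.Injective h) :
    ∃ σ : Equiv.Perm (Fin n), ∀ i j, σ i < σ j ↔ h i < h j := by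
  have hm : StrictMono (h ∘ Tuple.sort h) :=
    (Tuple.monotone_sort h).strictMono_of_injective (hh.comp (Tuple.sort h).injective)
  refine ⟨(Tuple.sort h)⁻¹, fun i j => ?_⟩
  rw [← hm.lt_iff_lt]
  simp

/-- The common counting scheme: `F l` lists the points of the `l`-th pattern from left to right, for
`n - 1` choices of `l`. Two patterns differ once some pair of positions is ordered oppositely in
them. -/
theorem le_card_patterns {n : ℕ} (hn : 2 ≤ n) {x y : α → ℝ} (hy : Function.Injective y)
    (F : ℕ → ℕ → α) (hx : ∀ l, l < n - 1 → ∀ i j, i < j → j < n → x (F l i) < x (F l j))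
    (hfl : ∀ l, l < n - 1 → y (F l (n - 1)) < y (F l 0))
    (hd : ∀ l l', l < l' → l' < n - 1 → ∃ i j, i < n ∧ j < n ∧
      (y (F l i) < y (F l j) ∧ y (F l' j) < y (F l' i) ∨
        y (F l j) < y (F l i) ∧ y (F l' i) < y (F l' j))) :
    n - 1 ≤ Nat.card {σ : Equiv.Perm (Fin n) // SumIndec σ ∧ HasPattern x y σ} := by
  have hsm : ∀ l : Fin (n - 1), StrictMono (x ∘ fun i : Fin n => F l i) :=
    fun l i j hij => hx l l.2 i j hij j.2
  have hp : ∀ l : Fin (n - 1), ∃ σ : Equiv.Perm (Fin n),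
      ∀ i j : Fin n, σ i < σ j ↔ y (F l i) < y (F l j) := fun l =>
    exists_pattern (h := fun i : Fin n => y (F l i)) (hy.comp (hsm l).injective.of_comp)
  choose σ hσ using hp
  -- The first and last entries form an inversion that straddles every cut.
  have hind : ∀ l, SumIndec (σ l) := fun l k hk hkn =>
    ⟨⟨0, by omega⟩, ⟨n - 1, by omega⟩, hk, by simp; omega, (hσ l _ _).2 (hfl l l.2)⟩
  have hinj : Function.Injective σ := by
    have key : ∀ l l' : Fin (n - 1), l < l' → σ l ≠ σ l' := by
      intro l l' hl e
      obtain ⟨i, j, hi, hj, h⟩ := hd l l' hl l'.2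
      have h1 := hσ l ⟨i, hi⟩ ⟨j, hj⟩
      have h2 := hσ l' ⟨i, hi⟩ ⟨j, hj⟩
      rw [← e, h1] at h2
      rcases h with h | h
      · exact lt_asymm h.2 (h2.1 h.1)
      · exact lt_asymm h.1 (h2.2 h.2)
    intro l l' e
    rcases lt_trichotomy l l' with h | h | h
    · exact absurd e (key _ _ h)
    · exact h
    · exact absurd e.symm (key _ _ h)
  have := Nat.card_le_card_of_injective
    (fun l : Fin (n - 1) => (⟨σ l, hind l, fun i => F l i, hsm l, hσ l⟩ :
      {σ : Equiv.Perm (Fin n) // SumIndec σ ∧ HasPattern x y σ}))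
    fun l l' e => hinj (congrArg Subtype.val e)
  simpa using this

/-- The first eight terms of `u` form an increasing sequence of points. -/
def IncSeq (x y : α → ℝ) (u : ℕ → α) : Prop :=
  ∀ i j, i < j → j < 8 → x (u i) < x (u j) ∧ y (u i) < y (u j)

/-- The first eight terms of `u` form a decreasing sequence of points. -/
def DecSeq (x y : α → ℝ) (u : ℕ → α) : Prop :=
  ∀ i j, i < j → j < 8 → x (u i) < x (u j) ∧ y (u j) < y (u i)

variable {x y : α → ℝ} {u v w : ℕ → α} {a p : α}

/-- Taking `l + 1` points of `u` and the rest from `v` puts the first descent just after the points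
of `u`, so its position recovers `l`. -/
theorem rich_of_inc_skew (hy : Function.Injective y) (hu : IncSeq x y u)
    (hv : IncSeq x y v ∨ DecSeq x y v)
    (huv : ∀ i j, i < 8 → j < 8 → x (u i) < x (v j) ∧ y (v j) < y (u i)) : Rich x y := by
  intro n h2 h8
  have hvx : ∀ i j, i < j → j < 8 → x (v i) < x (v j) := by
    rcases hv with hv | hv
    · exact fun i j h h' => (hv i j h h').1
    · exact fun i j h h' => (hv i j h h').1
  refine le_card_patterns h2 hy (fun l k => if k < l + 1 then u k else v (k - (l + 1))) ?_ ?_ ?_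
  · intro l hl i j hij hj
    split_ifs with h1 h2 h2
    · exact (hu i j hij (by omega)).1
    · exact (huv _ _ (by omega) (by omega)).1
    · omega
    · exact hvx _ _ (by omega) (by omega)
  · intro l hl
    rw [if_neg (by omega), if_pos (by omega)]
    exact (huv _ _ (by omega) (by omega)).2
  · intro l l' hl hl'
    refine ⟨l, l + 1, by omega, by omega, Or.inr ⟨?_, ?_⟩⟩
    · rw [if_neg (by omega), if_pos (by omega)]
      exact (huv _ _ (by omega) (by omega)).2
    · rw [if_pos (by omega), if_pos (by omega)]
      exact (hu _ _ (by omega) (by omega)).2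

/-- The descending run includes the first point of `v`, so the first ascent, or its absence,
recovers `l`. -/
theorem rich_of_dec_skew_inc (hy : Function.Injective y) (hu : DecSeq x y u) (hv : IncSeq x y v)
    (huv : ∀ i j, i < 8 → j < 8 → x (u i) < x (v j) ∧ y (v j) < y (u i)) : Rich x y := by
  intro n h2 h8
  refine le_card_patterns h2 hy (fun l k => if k < l + 1 then u k else v (k - (l + 1))) ?_ ?_ ?_
  · intro l hl i j hij hj
    split_ifs with h1 h2 h2
    · exact (hu i j hij (by omega)).1
    · exact (huv _ _ (by omega) (by omega)).1
    · omega
    · exact (hv _ _ (by omega) (by omega)).1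
  · intro l hl
    rw [if_neg (by omega), if_pos (by omega)]
    exact (huv _ _ (by omega) (by omega)).2
  · intro l l' hl hl'
    refine ⟨l + 1, l + 2, by omega, by omega, Or.inl ⟨?_, ?_⟩⟩
    · rw [if_neg (by omega), if_neg (by omega)]
      exact (hv _ _ (by omega) (by omega)).2
    · rw [if_pos (by omega : l + 1 < l' + 1)]
      split_ifs
      · exact (hu _ _ (by omega) (by omega)).2
      · exact (huv _ _ (by omega) (by omega)).2

/-- `w` runs from right to left; `a` is to the right of `w` and above its lowest term. -/
theorem rich_of_dec_point_dec (hy : Function.Injective y)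
    (hw : ∀ i j, i < j → j < 8 → x (w j) < x (w i) ∧ y (w i) < y (w j)) (hv : DecSeq x y v)
    (hwa : ∀ i, i < 8 → x (w i) < x a) (hwa0 : y (w 0) < y a)
    (hwv : ∀ i j, i < 8 → j < 8 → y (v j) < y (w i))
    (hav : ∀ j, j < 8 → x a < x (v j) ∧ y (v j) < y a) : Rich x y := by
  intro n h2 h8
  refine le_card_patterns h2 hy
    (fun l k => if k < l then w (l - 1 - k) else if k = l then a else v (k - l - 1)) ?_ ?_ ?_
  · intro l hl i j hij hj
    split_ifs
    · exact (hw _ _ (by omega) (by omega)).1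
    · exact hwa _ (by omega)
    · exact (hwa _ (by omega)).trans (hav _ (by omega)).1
    all_goals try omega
    · exact (hav _ (by omega)).1
    · exact (hv _ _ (by omega) (by omega)).1
  · intro l hl
    rw [if_neg (by omega), if_neg (by omega)]
    split_ifs
    · exact hwv _ _ (by omega) (by omega)
    · exact (hav _ (by omega)).2
    · omega
  -- The only ascent is from `w 0` to `a`, at positions `l - 1` and `l`; for `l = 0` there is none.
  -- How `a` compares with the higher points of `w` is irrelevant.
  · intro l l' hl hl'
    refine ⟨l' - 1, l', by omega, by omega, Or.inr ⟨?_, ?_⟩⟩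
    · rw [if_neg (by omega), if_neg (by omega), if_neg (by omega)]
      split_ifs
      · exact (hav _ (by omega)).2
      · exact (hv _ _ (by omega) (by omega)).2
    · rw [if_pos (by omega), if_neg (by omega), if_pos rfl]
      simpa using hwa0

/-- The only ascent is from `p` to the first point of `v`, and its position depends on how many
points of `u` precede `p`. -/
theorem rich_of_dec_skew_point_dec (hy : Function.Injective y) (hu : DecSeq x y u)
    (hv : DecSeq x y v)
    (huv : ∀ i j, i < 8 → j < 8 → y (v j) < y (u i))
    (hup : ∀ i, i < 8 → x (u i) < x p ∧ y p < y (u i))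
    (hpv : ∀ j, j < 8 → x p < x (v j) ∧ y p < y (v j)) : Rich x y := by
  intro n h2 h8
  refine le_card_patterns h2 hy
    (fun l k => if k < l + 1 then u k else if k = l + 1 then p else v (k - l - 2)) ?_ ?_ ?_
  · intro l hl i j hij hj
    split_ifs
    · exact (hu _ _ (by omega) (by omega)).1
    · exact (hup _ (by omega)).1
    · exact (hup _ (by omega)).1.trans (hpv _ (by omega)).1
    all_goals try omega
    · exact (hpv _ (by omega)).1
    · exact (hv _ _ (by omega) (by omega)).1
  · intro l hl
    rw [if_neg (by omega : ¬ n - 1 < l + 1), if_pos (by omega : 0 < l + 1)]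
    split_ifs
    · exact (hup _ (by omega)).2
    · exact huv _ _ (by omega) (by omega)
  · intro l l' hl hl'
    refine ⟨l + 1, l + 2, by omega, by omega, Or.inl ⟨?_, ?_⟩⟩
    · rw [if_neg (by omega), if_pos (by omega), if_neg (by omega), if_neg (by omega)]
      exact (hpv _ (by omega)).2
    · rw [if_pos (by omega : l + 1 < l' + 1)]
      split_ifs
      · exact (hu _ _ (by omega) (by omega)).2
      · exact (hup _ (by omega)).2
      · omega

/-- The point `a` on top makes everything indecomposable. After it, the patterns are told apart by
the peak if `u` increases and by the only ascent if `u` decreases. The number of points of `u`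
starts at 0 in the first case and at 1 in the second, because the omitted extreme would repeat a
pattern. -/
theorem rich_of_point_skew_sum (hy : Function.Injective y) (hu : IncSeq x y u ∨ DecSeq x y u)
    (hv : DecSeq x y v)
    (hau : ∀ i, i < 8 → x a < x (u i) ∧ y (u i) < y a)
    (huv : ∀ i j, i < 8 → j < 8 → x (u i) < x (v j) ∧ y (u i) < y (v j))
    (hva : ∀ j, j < 8 → y (v j) < y a) : Rich x y := by
  intro n h2 h8
  rcases hu with hu | hu
  · refine le_card_patterns h2 hy
      (fun l k => if k = 0 then a else if k ≤ l then u (k - 1) else v (k - l - 1)) ?_ ?_ ?_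
    · intro l hl i j hij hj
      split_ifs
      all_goals try omega
      · exact (hau _ (by omega)).1
      · exact (hau 0 (by omega)).1.trans (huv 0 _ (by omega) (by omega)).1
      · exact (hu _ _ (by omega) (by omega)).1
      · exact (huv _ _ (by omega) (by omega)).1
      · exact (hv _ _ (by omega) (by omega)).1
    · intro l hl
      rw [if_neg (by omega), if_neg (by omega), if_pos rfl]
      exact hva _ (by omega)
    · intro l l' hl hl'
      refine ⟨l + 1, l + 2, by omega, by omega, Or.inr ⟨?_, ?_⟩⟩
      · rw [if_neg (by omega), if_neg (by omega), if_neg (by omega), if_neg (by omega)]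
        exact (hv _ _ (by omega) (by omega)).2
      · rw [if_neg (by omega), if_pos (by omega : l + 1 ≤ l'), if_neg (by omega)]
        split_ifs
        · exact (hu _ _ (by omega) (by omega)).2
        · exact (huv _ _ (by omega) (by omega)).2
  · refine le_card_patterns h2 hy
      (fun l k => if k = 0 then a else if k ≤ l + 1 then u (k - 1) else v (k - l - 2)) ?_ ?_ ?_
    · intro l hl i j hij hj
      split_ifs
      all_goals try omega
      · exact (hau _ (by omega)).1
      · exact (hau 0 (by omega)).1.trans (huv 0 _ (by omega) (by omega)).1
      · exact (hu _ _ (by omega) (by omega)).1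
      · exact (huv _ _ (by omega) (by omega)).1
      · exact (hv _ _ (by omega) (by omega)).1
    · intro l hl
      rw [if_neg (by omega), if_pos rfl]
      split_ifs
      · exact (hau _ (by omega)).2
      · exact hva _ (by omega)
    · intro l l' hl hl'
      refine ⟨l + 1, l + 2, by omega, by omega, Or.inl ⟨?_, ?_⟩⟩
      · rw [if_neg (by omega), if_pos (by omega), if_neg (by omega), if_neg (by omega)]
        exact (huv _ _ (by omega) (by omega)).2
      · rw [if_neg (by omega), if_pos (by omega), if_neg (by omega), if_pos (by omega)]
        exact (hu _ _ (by omega) (by omega)).2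

end PermClass

/-! ### Monotone sequences of points -/

namespace PermClass

variable {α : Type*} {x y : α → ℝ}

theorem exists_seq_of_lt_card (hx : Function.Injective x) (b : ℕ) (S : Finset α)
    (hb : b < S.card) :
    ∃ u : ℕ → α, (∀ i ≤ b, u i ∈ S) ∧ ∀ i j, i < j → j ≤ b → x (u i) < x (u j) := by
  classical
  induction b generalizing S with
  | zero =>
    obtain ⟨s, hs⟩ := Finset.card_pos.1 hb
    exact ⟨fun _ => s, fun _ _ => hs, fun i j h h' => by omega⟩
  | succ b ih =>
    obtain ⟨s, hs, hmin⟩ := S.exists_min_image x (Finset.card_pos.1 (by omega))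
    obtain ⟨u, hu, hux⟩ := ih (S.erase s) (by rw [Finset.card_erase_of_mem hs]; omega)
    refine ⟨fun i => if i = 0 then s else u (i - 1), fun i hi => ?_, fun i j hij hj => ?_⟩
    · dsimp only
      split_ifs
      · exact hs
      · exact Finset.mem_of_mem_erase (hu _ (by omega))
    · dsimp only
      rw [if_neg (by omega : j ≠ 0)]
      split_ifs
      · have h := Finset.mem_erase.1 (hu (j - 1) (by omega))
        exact lt_of_le_of_ne (hmin _ h.2) fun e => h.1 (hx e).symm
      · exact hux _ _ (by omega) (by omega)

/-- The Erdős–Szekeres theorem for points in the plane. -/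
theorem exists_monotone_seq (hx : Function.Injective x) (hy : Function.Injective y) (a b : ℕ)
    (S : Finset α) (h : a * b < S.card) :
    (∃ u : ℕ → α, (∀ i ≤ a, u i ∈ S) ∧
      ∀ i j, i < j → j ≤ a → x (u i) < x (u j) ∧ y (u i) < y (u j)) ∨
    (∃ u : ℕ → α, (∀ i ≤ b, u i ∈ S) ∧
      ∀ i j, i < j → j ≤ b → x (u i) < x (u j) ∧ y (u j) < y (u i)) := by
  classical
  induction a generalizing S with
  | zero =>
    obtain ⟨s, hs⟩ := Finset.card_pos.1 (by omega : 0 < S.card)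
    exact Or.inl ⟨fun _ => s, fun _ _ => hs, fun i j h h' => by omega⟩
  | succ a ih =>
    -- `U` consists of the points with no point of `S` below and to the left; sorted by `x` it is
    -- decreasing. Every point of `T` can be preceded by a point of `S`, so an increasing sequence
    -- in `T` extends by one.
    set T := S.filter fun p => ∃ q ∈ S, x q < x p ∧ y q < y p with hT
    set U := S.filter fun p => ¬ ∃ q ∈ S, x q < x p ∧ y q < y p with hU
    have hcard : T.card + U.card = S.card := Finset.card_filter_add_card_filter_not _
    rcases lt_or_ge b U.card with hb | hb
    · obtain ⟨u, hu, hux⟩ := exists_seq_of_lt_card hx b U hb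
      refine Or.inr ⟨u, fun i hi => Finset.mem_of_mem_filter _ (hu i hi), fun i j hij hj => ?_⟩
      have h1 := hux i j hij hj
      refine ⟨h1, ?_⟩
      have hi := (Finset.mem_filter.1 (hu i (by omega))).1
      have hj := (Finset.mem_filter.1 (hu j (by omega))).2
      push Not at hj
      refine lt_of_le_of_ne (hj _ hi h1) fun e => ?_
      rw [hy e] at h1
      exact lt_irrefl _ h1
    · rcases ih T (by rw [Nat.succ_mul] at h; omega) with ⟨u, hu, hux⟩ | ⟨u, hu, hux⟩
      · obtain ⟨q, hq, hq0⟩ := (Finset.mem_filter.1 (hu 0 (by omega))).2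
        refine Or.inl ⟨fun i => if i = 0 then q else u (i - 1), fun i hi => ?_,
          fun i j hij hj => ?_⟩
        · dsimp only
          split_ifs
          · exact hq
          · exact Finset.mem_of_mem_filter _ (hu _ (by omega))
        · dsimp only
          rw [if_neg (by omega : j ≠ 0)]
          split_ifs
          · rcases Nat.eq_zero_or_pos (j - 1) with h0 | h0
            · rw [h0]; exact hq0
            · have := hux 0 (j - 1) h0 (by omega)
              exact ⟨hq0.1.trans this.1, hq0.2.trans this.2⟩
          · exact hux _ _ (by omega) (by omega)
      · exact Or.inr ⟨u, fun i hi => Finset.mem_of_mem_filter _ (hu i hi), hux⟩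

theorem exists_incSeq_or_decSeq (hx : Function.Injective x) (hy : Function.Injective y)
    {S : Finset α} (hS : 50 ≤ S.card) :
    ∃ u : ℕ → α, (∀ i < 8, u i ∈ S) ∧ (IncSeq x y u ∨ DecSeq x y u) := by
  rcases exists_monotone_seq hx hy 7 7 S (by omega) with ⟨u, hu, h⟩ | ⟨u, hu, h⟩
  · exact ⟨u, fun i hi => hu i (by omega), Or.inl fun i j hij hj => h i j hij (by omega)⟩
  · exact ⟨u, fun i hi => hu i (by omega), Or.inr fun i j hij hj => h i j hij (by omega)⟩

/-! ### How a corner quadrant meets its two large neighbours -/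

/-- `A` is to the left of and above `B`, while `C` is below `A` and to the left of `B`. -/
structure Corner (x y : α → ℝ) (A B C : Finset α) : Prop where
  injX : Function.Injective x
  injY : Function.Injective y
  skew : ∀ a ∈ A, ∀ b ∈ B, x a < x b ∧ y b < y a
  below : ∀ p ∈ C, ∀ a ∈ A, y p < y a
  left : ∀ p ∈ C, ∀ b ∈ B, x p < x b

variable {A B C : Finset α}

theorem Corner.transpose (h : Corner x y A B C) : Corner y x B A C :=
  ⟨h.injY, h.injX, fun b hb a ha => (h.skew a ha b hb).symm, h.left, h.below⟩

/-- Erdős–Szekeres gives eight monotone points in each of `S` and `T` (`50 = 7 * 7 + 1`); an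
increasing choice in `S` would be rich whatever happens in `T`. -/
theorem Corner.exists_decSeq_left (h : Corner x y A B C) (hr : ¬ Rich x y) {S T : Finset α}
    (hS : S ⊆ A) (hT : T ⊆ B) (hSc : 50 ≤ S.card) (hTc : 50 ≤ T.card) :
    ∃ u : ℕ → α, (∀ i < 8, u i ∈ S) ∧ DecSeq x y u := by
  obtain ⟨u, hu, hum⟩ := exists_incSeq_or_decSeq h.injX h.injY hSc
  obtain ⟨v, hv, hvm⟩ := exists_incSeq_or_decSeq h.injX h.injY hTc
  refine ⟨u, hu, hum.resolve_left fun hi => hr (rich_of_inc_skew h.injY hi hvm ?_)⟩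
  exact fun i j hi hj => h.skew _ (hS (hu i hi)) _ (hT (hv j hj))

theorem Corner.exists_decSeq_right (h : Corner x y A B C) (hr : ¬ Rich x y) {S T : Finset α}
    (hS : S ⊆ A) (hT : T ⊆ B) (hSc : 50 ≤ S.card) (hTc : 50 ≤ T.card) :
    ∃ v : ℕ → α, (∀ i < 8, v i ∈ T) ∧ DecSeq x y v := by
  obtain ⟨u, hu, hud⟩ := h.exists_decSeq_left hr hS hT hSc hTc
  obtain ⟨v, hv, hvm⟩ := exists_incSeq_or_decSeq h.injX h.injY hTc
  refine ⟨v, hv, hvm.resolve_left fun hi => hr (rich_of_dec_skew_inc h.injY hud hi ?_)⟩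
  exact fun i j hi hj => h.skew _ (hS (hu i hi)) _ (hT (hv j hj))

open Classical in
theorem Corner.rich_of_adjacent_both (h : Corner x y A B C) {p a : α} (hp : p ∈ C)
    (hA : 50 ≤ (A.filter fun a => x a < x p).card) (hB : 50 ≤ (B.filter fun b => y b < y p).card)
    (ha : a ∈ A) (hpa : x p < x a) : Rich x y := by
  by_contra hr
  obtain ⟨u, hu, hud⟩ := h.exists_decSeq_left hr (Finset.filter_subset _ _)
    (Finset.filter_subset _ _) hA hB
  obtain ⟨v, hv, hvd⟩ := h.exists_decSeq_right hr (Finset.filter_subset _ _)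
    (Finset.filter_subset _ _) hA hB
  simp only [Finset.mem_filter] at hu hv
  -- Read from right to left, `w` is `p` followed by the last seven points of `u`. Its lowest point
  -- is `p`, so the ascent is from `p` to `a`.
  refine hr (rich_of_dec_point_dec h.injY (w := fun i => if i = 0 then p else u (8 - i)) (a := a)
    (v := v) ?_ hvd ?_ ?_ ?_ ?_)
  · intro i j hij hj
    rw [if_neg (by omega : j ≠ 0)]
    split_ifs
    · have := hu (8 - j) (by omega)
      exact ⟨this.2, h.below p hp _ this.1⟩
    · exact hud _ _ (by omega) (by omega)
  · intro i hi
    split_ifs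
    · exact hpa
    · exact (hu _ (by omega)).2.trans hpa
  · simpa using h.below p hp a ha
  · intro i j hi hj
    split_ifs
    · exact (hv j hj).2
    · exact (h.skew _ (hu _ (by omega)).1 _ (hv j hj).1).2
  · exact fun j hj => h.skew a ha _ (hv j hj).1

open Classical in
theorem Corner.rich_of_adjacent_left (h : Corner x y A B C) {p : α} (hp : p ∈ C)
    (hA : 50 ≤ (A.filter fun a => x a < x p).card)
    (hB : 50 ≤ (B.filter fun b => y p < y b).card) : Rich x y := by
  by_contra hr
  obtain ⟨u, hu, hud⟩ := h.exists_decSeq_left hr (Finset.filter_subset _ _)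
    (Finset.filter_subset _ _) hA hB
  obtain ⟨v, hv, hvd⟩ := h.exists_decSeq_right hr (Finset.filter_subset _ _)
    (Finset.filter_subset _ _) hA hB
  simp only [Finset.mem_filter] at hu hv
  exact hr (rich_of_dec_skew_point_dec h.injY (p := p) hud hvd
    (fun i j hi hj => (h.skew _ (hu i hi).1 _ (hv j hj).1).2)
    (fun i hi => ⟨(hu i hi).2, h.below p hp _ (hu i hi).1⟩)
    fun j hj => ⟨h.left p hp _ (hv j hj).1, (hv j hj).2⟩)

open Classical in
theorem Corner.le_card_filter_above (h : Corner x y A B C) {p : α} (hp : p ∈ C)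
    (hB : 100 ≤ B.card) (hp' : (B.filter fun b => y b < y p).card < 50) :
    50 ≤ (B.filter fun b => y p < y b).card := by
  have h1 := Finset.card_filter_add_card_filter_not (s := B) (fun b => y b < y p)
  have h2 : (B.filter fun b => ¬ y b < y p) = B.filter fun b => y p < y b := by
    refine Finset.filter_congr fun b hb => ?_
    have : y b ≠ y p := fun e => by
      have := h.left p hp b hb
      rw [h.injY e] at this
      exact lt_irrefl _ this
    rw [not_lt]
    exact ⟨fun hle => lt_of_le_of_ne hle this.symm, le_of_lt⟩
  rw [h2] at h1
  omega

open Classical in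
-- Fifty such points would contain eight monotone ones. Together with a point of `A` to their left
-- and decreasing points of `B` above them, these form the configuration of
-- `rich_of_point_skew_sum`.
theorem Corner.few_adjacent_left (h : Corner x y A B C) (hr : ¬ Rich x y)
    (hA : 100 ≤ A.card) (hB : 100 ≤ B.card) :
    (C.filter fun p => (∃ a ∈ A, x a < x p) ∧ (B.filter fun b => y b < y p).card < 50).card < 50 := by
  by_contra hc
  push Not at hc
  obtain ⟨u, hu, hum⟩ := exists_incSeq_or_decSeq h.injX h.injY hc
  simp only [Finset.mem_filter] at hu
  obtain ⟨m, hm, hmax⟩ := (Finset.range 8).exists_max_image (fun i => y (u i)) ⟨0, by simp⟩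
  simp only [Finset.mem_range] at hm hmax
  -- Points of `B` above the highest `u m` are above every `u i`; likewise, below, a point `a` left
  -- of `u 0` is left of every `u i`.
  have hBm := h.le_card_filter_above (hu m hm).1 hB (hu m hm).2.2
  obtain ⟨v, hv, hvd⟩ := h.exists_decSeq_right hr (Finset.Subset.refl A)
    (Finset.filter_subset _ _) (by omega) hBm
  simp only [Finset.mem_filter] at hv
  obtain ⟨a, ha, hau⟩ := (hu 0 (by omega)).2.1
  have hux : ∀ i < 8, x (u 0) ≤ x (u i) := by
    intro i hi
    rcases Nat.eq_zero_or_pos i with rfl | h0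
    · exact le_rfl
    · rcases hum with hum | hum
      · exact (hum 0 i h0 hi).1.le
      · exact (hum 0 i h0 hi).1.le
  exact hr (rich_of_point_skew_sum h.injY (a := a) hum hvd
    (fun i hi => ⟨hau.trans_le (hux i hi), h.below _ (hu i hi).1 a ha⟩)
    (fun i j hi hj => ⟨h.left _ (hu i hi).1 _ (hv j hj).1, (hmax i hi).trans_lt (hv j hj).2⟩)
    fun j hj => (h.skew a ha _ (hv j hj).1).2)

open Classical in
-- Many on both sides gives `rich_of_adjacent_both`. Many on one side only leaves at least fifty
-- points beyond `p` on the other, which gives `rich_of_adjacent_left`.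
theorem Corner.few_adjacent_of_nonadjacent (h : Corner x y A B C) (hr : ¬ Rich x y)
    (hA : 100 ≤ A.card) (hB : 100 ≤ B.card) {p : α} (hp : p ∈ C)
    (hn : (∃ a ∈ A, x p < x a) ∨ ∃ b ∈ B, y p < y b) :
    (A.filter fun a => x a < x p).card < 50 ∧ (B.filter fun b => y b < y p).card < 50 := by
  have hr' : ¬ Rich y x := fun h' => hr h'.transpose
  by_contra hcon
  rw [not_and_or, not_lt, not_lt] at hcon
  by_cases h1 : 50 ≤ (A.filter fun a => x a < x p).card
  · by_cases h2 : 50 ≤ (B.filter fun b => y b < y p).card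
    · rcases hn with ⟨a, ha, hpa⟩ | ⟨b, hb, hpb⟩
      · exact hr (h.rich_of_adjacent_both hp h1 h2 ha hpa)
      · exact hr' (h.transpose.rich_of_adjacent_both hp h2 h1 hb hpb)
    · exact hr (h.rich_of_adjacent_left hp h1 (h.le_card_filter_above hp hB (not_le.1 h2)))
  · exact hr' (h.transpose.rich_of_adjacent_left hp (hcon.resolve_left h1)
      (h.transpose.le_card_filter_above hp hA (not_le.1 h1)))

/-- `p` is below and to the left of all of `A` and `B`. -/
def IsOuter (x y : α → ℝ) (A B : Finset α) (p : α) : Prop :=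
  (∀ a ∈ A, x p < x a) ∧ ∀ b ∈ B, y p < y b

/-- `p` is to the right of `A` and above `B`. -/
def IsInner (x y : α → ℝ) (A B : Finset α) (p : α) : Prop :=
  (∀ a ∈ A, x a < x p) ∧ ∀ b ∈ B, y b < y p

open Classical in
-- A point that is not inner has few points of `A` to its left and few of `B` below. If it is not
-- outer either, at least one such point exists, so it is among the at most 49 points of
-- `few_adjacent_left` or of its transpose.
theorem Corner.card_mixed_le (h : Corner x y A B C) (hr : ¬ Rich x y)
    (hA : 100 ≤ A.card) (hB : 100 ≤ B.card) :
    (C.filter fun p => ¬ IsOuter x y A B p ∧ ¬ IsInner x y A B p).card ≤ 98 := by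
  have hr' : ¬ Rich y x := fun h' => hr h'.transpose
  have h1 := h.few_adjacent_left hr hA hB
  have h2 := h.transpose.few_adjacent_left hr' hB hA
  refine (Finset.card_le_card ?_).trans
    ((Finset.card_union_le (C.filter fun p => (∃ a ∈ A, x a < x p) ∧
      (B.filter fun b => y b < y p).card < 50) (C.filter fun p => (∃ b ∈ B, y b < y p) ∧
      (A.filter fun a => x a < x p).card < 50)).trans (by omega))
  intro p hp
  rw [Finset.mem_filter] at hp
  obtain ⟨hpC, ho, hi⟩ := hp
  have hxA : ∀ a ∈ A, x a ≠ x p := fun a ha e => by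
    have := h.below p hpC a ha
    rw [h.injX e] at this
    exact lt_irrefl _ this
  have hyB : ∀ b ∈ B, y b ≠ y p := fun b hb e => by
    have := h.left p hpC b hb
    rw [h.injY e] at this
    exact lt_irrefl _ this
  have hn : (∃ a ∈ A, x p < x a) ∨ ∃ b ∈ B, y p < y b := by
    by_contra hcon
    push Not at hcon
    exact hi ⟨fun a ha => lt_of_le_of_ne (hcon.1 a ha) (hxA a ha),
      fun b hb => lt_of_le_of_ne (hcon.2 b hb) (hyB b hb)⟩
  have hadj : (∃ a ∈ A, x a < x p) ∨ ∃ b ∈ B, y b < y p := by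
    by_contra hcon
    push Not at hcon
    exact ho ⟨fun a ha => lt_of_le_of_ne (hcon.1 a ha) (hxA a ha).symm,
      fun b hb => lt_of_le_of_ne (hcon.2 b hb) (hyB b hb).symm⟩
  obtain ⟨k1, k2⟩ := h.few_adjacent_of_nonadjacent hr hA hB hpC hn
  rw [Finset.mem_union, Finset.mem_filter, Finset.mem_filter]
  rcases hadj with ha | hb
  · exact Or.inl ⟨hpC, ha, k2⟩
  · exact Or.inr ⟨hpC, hb, k1⟩

end PermClass

/-! ### Covering separated sets by independent rectangles -/

namespace PermClass

variable {α : Type*} {x y : α → ℝ}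

/-- All but `r` of the points `(x i, y i)` are covered by `q` independent rectangles
`[a k, b k] × [a' k, b' k]` that avoid the vertical line at `c`. -/
def Coverable (x y : α → ℝ) (c : ℝ) (q r : ℕ) : Prop :=
  ∃ a b a' b' : Fin q → ℝ, (∀ k, a k < b k) ∧ (∀ k, a' k < b' k) ∧
    (∀ k l, k ≠ l → b k < a l ∨ b l < a k) ∧ (∀ k l, k ≠ l → b' k < a' l ∨ b' l < a' k) ∧
    (∀ k, b k < c ∨ c < a k) ∧
    {i | ∀ k, ¬ (a k ≤ x i ∧ x i ≤ b k ∧ a' k ≤ y i ∧ y i ≤ b' k)}.ncard ≤ r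

theorem Coverable.reflect_y {c s : ℝ} {q r : ℕ} (h : Coverable x (fun i => s - y i) c q r) :
    Coverable x y c q r := by
  obtain ⟨a, b, a', b', h1, h2, h3, h4, h5, h6⟩ := h
  refine ⟨a, b, fun k => s - b' k, fun k => s - a' k, h1, fun k => by linarith [h2 k], h3,
    fun k l hkl => ?_, h5, ?_⟩
  · rcases h4 k l hkl with h | h
    · right; linarith
    · left; linarith
  · convert h6 using 4 with i
    refine forall_congr' fun k => not_congr (and_congr_right fun _ => and_congr_right fun _ => ?_)
    constructor <;> rintro ⟨h, h'⟩ <;> constructor <;> linarith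

theorem Coverable.reflect_x {c s : ℝ} {q r : ℕ}
    (h : Coverable (fun i => s - x i) y (s - c) q r) : Coverable x y c q r := by
  obtain ⟨a, b, a', b', h1, h2, h3, h4, h5, h6⟩ := h
  refine ⟨fun k => s - b k, fun k => s - a k, a', b', fun k => by linarith [h1 k], h2,
    fun k l hkl => ?_, h4, fun k => ?_, ?_⟩
  · rcases h3 k l hkl with h | h
    · right; linarith
    · left; linarith
  · rcases h5 k with h | h
    · right; linarith
    · left; linarith
  · convert h6 using 4 with i
    refine forall_congr' fun k => not_congr ?_
    constructor <;> rintro ⟨h, h', h''⟩ <;> refine ⟨?_, ?_, h''⟩ <;> linarith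

theorem exists_pos_lt_of_finite {ι : Type*} [Finite ι] (f : ι → ℝ) (hf : ∀ i, 0 < f i) :
    ∃ ε > 0, ∀ i, ε < f i := by
  have h : ∀ᶠ ε in 𝓝[>] (0 : ℝ), ∀ i, ε < f i :=
    eventually_all.2 fun i => nhdsWithin_le_nhds (eventually_lt_nhds (hf i))
  obtain ⟨ε, h1, h2⟩ := (h.and self_mem_nhdsWithin).exists
  exact ⟨ε, h2, h1⟩

theorem exists_lt_sub_of_finite {ι : Type*} [Finite ι] (f : ι → ℝ) :
    ∃ ε > 0, ∀ i j, f i < f j → f i + ε < f j - ε := by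
  -- Pairs that are not increasing get the harmless bound 1.
  obtain ⟨ε, h1, h2⟩ := exists_pos_lt_of_finite
    (fun p : ι × ι => if f p.1 < f p.2 then (f p.2 - f p.1) / 2 else 1) (fun p => by
      split_ifs with h
      · linarith
      · norm_num)
  refine ⟨ε, h1, fun i j hij => ?_⟩
  have := h2 (i, j)
  simp only [hij, if_true] at this
  linarith

/-- Sets of points that are separated by vertical and by horizontal lines can be enclosed in
independent rectangles; indices of empty sets get rectangles far away. -/
theorem coverable_of_separated [Fintype α] {c : ℝ} {q r : ℕ} (hc : ∀ i, x i ≠ c)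
    (S : Fin q → Finset α)
    (hx : ∀ k l, k < l → ∀ i ∈ S k, ∀ j ∈ S l, x i < x j)
    (hy : ∀ k l, k < l → (∀ i ∈ S k, ∀ j ∈ S l, y i < y j) ∨ ∀ i ∈ S k, ∀ j ∈ S l, y j < y i)
    (hL : ∀ k, (∀ i ∈ S k, x i < c) ∨ ∀ i ∈ S k, c < x i)
    (hr : {i | ∀ k, i ∉ S k}.ncard ≤ r) : Coverable x y c q r := by
  obtain ⟨ε₁, hε₁, h1⟩ := exists_lt_sub_of_finite x
  obtain ⟨ε₂, hε₂, h2⟩ := exists_lt_sub_of_finite y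
  obtain ⟨ε₃, hε₃, h3⟩ := exists_pos_lt_of_finite (fun i => |x i - c|)
    (fun i => abs_pos.2 (sub_ne_zero.2 (hc i)))
  -- Bounding boxes are thickened by `ε` to be nondegenerate. It must preserve the gaps in `x` and
  -- in `y` and the distance to the line; the bound 1 keeps the boxes below `M`, where the dummy
  -- squares start.
  obtain ⟨ε, hε, hlt⟩ := exists_pos_lt_of_finite ![ε₁, ε₂, ε₃, 1] (by
    intro i; fin_cases i <;> simp [hε₁, hε₂, hε₃])
  have l1 : ε < ε₁ := hlt 0
  have l2 : ε < ε₂ := hlt 1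
  have l3 : ε < ε₃ := hlt 2
  have l4 : ε < 1 := hlt 3
  obtain ⟨M, hM⟩ : ∃ M, c < M ∧ ∀ i, x i + 1 < M ∧ y i + 1 < M := by
    have : ∀ᶠ M : ℝ in atTop, c < M ∧ ∀ i, x i + 1 < M ∧ y i + 1 < M :=
      (eventually_gt_atTop c).and (eventually_all.2 fun i =>
        (eventually_gt_atTop _).and (eventually_gt_atTop _))
    exact this.exists
  have key : ∀ k, ∃ a b a' b' : ℝ, a < b ∧ a' < b' ∧
      (∀ i ∈ S k, a ≤ x i ∧ x i ≤ b ∧ a' ≤ y i ∧ y i ≤ b') ∧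
      ((∃ i₁ ∈ S k, ∃ i₂ ∈ S k, ∃ i₃ ∈ S k, ∃ i₄ ∈ S k,
          a = x i₁ - ε ∧ b = x i₂ + ε ∧ a' = y i₃ - ε ∧ b' = y i₄ + ε) ∨
        (a = M + 2 * k ∧ b = M + 2 * k + 1 ∧ a' = M + 2 * k ∧ b' = M + 2 * k + 1)) := by
    intro k
    rcases (S k).eq_empty_or_nonempty with h | h
    · refine ⟨M + 2 * k, M + 2 * k + 1, M + 2 * k, M + 2 * k + 1, by linarith, by linarith,
        ?_, Or.inr ⟨rfl, rfl, rfl, rfl⟩⟩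
      simp [h]
    · obtain ⟨i₁, m₁, e₁⟩ := (S k).exists_min_image x h
      obtain ⟨i₂, m₂, e₂⟩ := (S k).exists_max_image x h
      obtain ⟨i₃, m₃, e₃⟩ := (S k).exists_min_image y h
      obtain ⟨i₄, m₄, e₄⟩ := (S k).exists_max_image y h
      refine ⟨x i₁ - ε, x i₂ + ε, y i₃ - ε, y i₄ + ε, by linarith [e₁ i₂ m₂],
        by linarith [e₃ i₄ m₄], fun i hi => ⟨?_, ?_, ?_, ?_⟩,
        Or.inl ⟨i₁, m₁, i₂, m₂, i₃, m₃, i₄, m₄, rfl, rfl, rfl, rfl⟩⟩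
      · linarith [e₁ i hi]
      · linarith [e₂ i hi]
      · linarith [e₃ i hi]
      · linarith [e₄ i hi]
  choose a b a' b' hab hab' hcov hcase using key
  have far : ∀ k l : Fin q, k < l → (M + 2 * (k : ℝ) + 1) < M + 2 * (l : ℝ) := by
    intro k l hkl
    have : ((k : ℕ) : ℝ) + 1 ≤ (l : ℕ) := by exact_mod_cast hkl
    linarith
  have hnn : ∀ k : Fin q, (0 : ℝ) ≤ ((k : ℕ) : ℝ) := fun k => Nat.cast_nonneg _
  have hsep : ∀ k l, k < l → (b k < a l ∨ b l < a k) ∧ (b' k < a' l ∨ b' l < a' k) := by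
    intro k l hkl
    rcases hcase k with ⟨i₁, m₁, i₂, m₂, i₃, m₃, i₄, m₄, f₁, f₂, f₃, f₄⟩ | ⟨f₁, f₂, f₃, f₄⟩ <;>
    rcases hcase l with ⟨j₁, n₁, j₂, n₂, j₃, n₃, j₄, n₄, g₁, g₂, g₃, g₄⟩ | ⟨g₁, g₂, g₃, g₄⟩ <;>
    rw [f₁, f₂, f₃, f₄, g₁, g₂, g₃, g₄]
    · refine ⟨Or.inl ?_, ?_⟩
      · linarith [h1 _ _ (hx k l hkl i₂ m₂ j₁ n₁)]
      · rcases hy k l hkl with h | h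
        · left; linarith [h2 _ _ (h i₄ m₄ j₃ n₃)]
        · right; linarith [h2 _ _ (h i₃ m₃ j₄ n₄)]
    · have := hnn l
      exact ⟨Or.inl (by linarith [(hM.2 i₂).1]), Or.inl (by linarith [(hM.2 i₄).2])⟩
    · have := hnn k
      exact ⟨Or.inr (by linarith [(hM.2 j₂).1]), Or.inr (by linarith [(hM.2 j₄).2])⟩
    · exact ⟨Or.inl (far k l hkl), Or.inl (far k l hkl)⟩
  refine ⟨a, b, a', b', hab, hab', fun k l hkl => ?_, fun k l hkl => ?_, fun k => ?_, ?_⟩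
  · rcases lt_or_gt_of_ne hkl with h | h
    · exact (hsep k l h).1
    · exact (hsep l k h).1.symm
  · rcases lt_or_gt_of_ne hkl with h | h
    · exact (hsep k l h).2
    · exact (hsep l k h).2.symm
  · rcases hcase k with ⟨i₁, m₁, i₂, m₂, -, -, -, -, f₁, f₂, -, -⟩ | ⟨f₁, f₂, -, -⟩
    · rcases hL k with h | h
      · left
        have e := h3 i₂
        rw [abs_of_neg (sub_neg.2 (h i₂ m₂))] at e
        linarith
      · right
        have e := h3 i₁
        rw [abs_of_pos (sub_pos.2 (h i₁ m₁))] at e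
        linarith
    · right
      linarith [hnn k, hM.1]
  · refine (Set.ncard_le_ncard ?_ (Set.toFinite {i | ∀ k, i ∉ S k})).trans hr
    exact fun i hi k hk => hi k (hcov k i hk)

/-! ### The four quadrants cut out by a line -/

theorem card_filter_perm_lt {n m : ℕ} (e : Equiv.Perm (Fin n)) (hm : m ≤ n) :
    (Finset.univ.filter fun i => (e i : ℕ) < m).card = m := by
  have : (Finset.univ.filter fun i => (e i : ℕ) < m) =
      (Finset.univ.filter fun i : Fin n => (i : ℕ) < m).map e.symm.toEmbedding := by
    ext i
    simp [Finset.mem_map_equiv]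
  rw [this, Finset.card_map]
  simp [Fin.card_filter_val_lt, hm]

open Classical in
-- Both coordinates are arbitrary permutations of the index set, so one statement serves vertical
-- lines, horizontal lines and reflected plots.
theorem coverable_of_not_rich {n : ℕ} (e e' : Equiv.Perm (Fin n)) {c : ℝ}
    (hc : ∀ i, ((e i : ℕ) : ℝ) ≠ c)
    (hr : ¬ Rich (fun i => ((e i : ℕ) : ℝ)) (fun i => ((e' i : ℕ) : ℝ))) :
    Coverable (fun i => ((e i : ℕ) : ℝ)) (fun i => ((e' i : ℕ) : ℝ)) c 6 198 := by
  set x : Fin n → ℝ := fun i => ((e i : ℕ) : ℝ) with hxdef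
  set y : Fin n → ℝ := fun i => ((e' i : ℕ) : ℝ) with hydef
  have ix : Function.Injective x := fun i j h => e.injective (Fin.ext (Nat.cast_injective h))
  have iy : Function.Injective y := fun i j h => e'.injective (Fin.ext (Nat.cast_injective h))
  set L : Finset (Fin n) := Finset.univ.filter fun i => x i < c with hLdef
  -- The horizontal cut is placed so that `W` and `L` have the same size, which gives `A` and `B`
  -- equal cardinality.
  set W : Finset (Fin n) := Finset.univ.filter fun i => (e' i : ℕ) < L.card with hWdef
  have hWL : W.card = L.card := card_filter_perm_lt e' (by simpa using Finset.card_le_univ L)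
  have hL : ∀ i, i ∈ L ↔ x i < c := fun i => by simp [hLdef]
  have hL' : ∀ i, i ∉ L → c < x i := fun i hi =>
    lt_of_le_of_ne (not_lt.1 fun h => hi ((hL i).2 h)) (hc i).symm
  have hLx : ∀ i ∈ L, ∀ j, j ∉ L → x i < x j := fun i hi j hj =>
    ((hL i).1 hi).trans (hL' j hj)
  have hWy : ∀ i ∈ W, ∀ j, j ∉ W → y i < y j := by
    intro i hi j hj
    simp only [hWdef, Finset.mem_filter, Finset.mem_univ, true_and, not_lt] at hi hj
    exact Nat.cast_lt.2 (lt_of_lt_of_le hi hj)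
  set A := L \ W with hA
  set B := W \ L with hB
  set C := L ∩ W with hC
  set E := (L ∪ W)ᶜ with hE
  have hAB : A.card = B.card := Finset.card_sdiff_comm hWL.symm
  have mA : ∀ i, i ∈ A ↔ i ∈ L ∧ i ∉ W := fun i => by simp [hA]
  have mB : ∀ i, i ∈ B ↔ i ∉ L ∧ i ∈ W := fun i => by simp [hB, and_comm]
  have mC : ∀ i, i ∈ C ↔ i ∈ L ∧ i ∈ W := fun i => by simp [hC]
  have mE : ∀ i, i ∈ E ↔ i ∉ L ∧ i ∉ W := fun i => by simp [hE]
  -- Here `A` and `B` lose at most `99 + 99 = 198` points; in the other case the mixed points number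
  -- at most `98 + 98`.
  rcases lt_or_ge A.card 100 with hsmall | hbig
  · refine coverable_of_separated hc ![C, E, ∅, ∅, ∅, ∅] ?_ ?_ ?_ ?_
    · intro k l hkl i hi j hj
      fin_cases k <;> fin_cases l <;> simp at hkl hi hj ⊢
      exact hLx i ((mC i).1 hi).1 j ((mE j).1 hj).1
    · intro k l hkl
      left
      intro i hi j hj
      fin_cases k <;> fin_cases l <;> simp at hkl hi hj ⊢
      exact hWy i ((mC i).1 hi).2 j ((mE j).1 hj).2
    · intro k
      fin_cases k <;> simp
      · exact Or.inl fun i hi => (hL i).1 ((mC i).1 hi).1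
      · exact Or.inr fun i hi => hL' i ((mE i).1 hi).1
    · have hsub : {i | ∀ k, i ∉ (![C, E, ∅, ∅, ∅, ∅] : Fin 6 → Finset (Fin n)) k} ⊆
          ((A ∪ B : Finset (Fin n)) : Set (Fin n)) := by
        intro i hi
        have h0 : i ∉ C := hi 0
        have h1 : i ∉ E := hi 1
        rw [mC] at h0
        rw [mE] at h1
        simp only [Finset.coe_union, Set.mem_union, Finset.mem_coe, mA, mB]
        tauto
      refine (Set.ncard_le_ncard hsub (Set.toFinite _)).trans ?_
      rw [Set.ncard_coe_finset]
      exact (Finset.card_union_le _ _).trans (by omega)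
  · have hbig' : 100 ≤ B.card := hAB ▸ hbig
    have cC : Corner x y A B C := by
      refine ⟨ix, iy, fun a ha b hb => ?_, fun p hp a ha => ?_, fun p hp b hb => ?_⟩
      · rw [mA] at ha
        rw [mB] at hb
        exact ⟨hLx a ha.1 b hb.1, hWy b hb.2 a ha.2⟩
      · exact hWy p ((mC p).1 hp).2 a ((mA a).1 ha).2
      · exact hLx p ((mC p).1 hp).1 b ((mB b).1 hb).1
    -- The half turn brings `E` to the lower left and exchanges `A` with `B`.
    have cE : Corner (fun i => -x i) (fun i => -y i) B A E := by
      refine ⟨neg_injective.comp ix, neg_injective.comp iy, fun b hb a ha => ?_,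
        fun p hp b hb => ?_, fun p hp a ha => ?_⟩
      · have := cC.skew a ha b hb
        exact ⟨neg_lt_neg this.1, neg_lt_neg this.2⟩
      · exact neg_lt_neg (hWy b ((mB b).1 hb).2 p ((mE p).1 hp).2)
      · exact neg_lt_neg (hLx a ((mA a).1 ha).1 p ((mE p).1 hp).1)
    have kC := cC.card_mixed_le hr hbig hbig'
    have kE := cE.card_mixed_le (fun h => hr h.rotate) hbig' hbig
    -- These witnesses separate the outer from the inner pieces, which are compared only through `A`
    -- and `B`.
    obtain ⟨a₀, ha₀⟩ : A.Nonempty := Finset.card_pos.1 (by omega)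
    obtain ⟨b₀, hb₀⟩ : B.Nonempty := Finset.card_pos.1 (by omega)
    set C₀ := C.filter (IsOuter x y A B) with hC₀
    set C₂ := C.filter (IsInner x y A B) with hC₂
    set E₀ := E.filter (IsOuter (fun i => -x i) (fun i => -y i) B A) with hE₀
    set E₂ := E.filter (IsInner (fun i => -x i) (fun i => -y i) B A) with hE₂
    have pA : ∀ i ∈ A, i ∈ L ∧ i ∉ W := fun i => (mA i).1
    have pB : ∀ i ∈ B, i ∉ L ∧ i ∈ W := fun i => (mB i).1
    have pC₀ : ∀ i ∈ C₀, i ∈ L ∧ i ∈ W ∧ (∀ a ∈ A, x i < x a) ∧ ∀ b ∈ B, y i < y b := by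
      intro i hi
      obtain ⟨h, h'⟩ := Finset.mem_filter.1 hi
      rw [mC] at h
      exact ⟨h.1, h.2, h'⟩
    have pC₂ : ∀ i ∈ C₂, i ∈ L ∧ i ∈ W ∧ (∀ a ∈ A, x a < x i) ∧ ∀ b ∈ B, y b < y i := by
      intro i hi
      obtain ⟨h, h'⟩ := Finset.mem_filter.1 hi
      rw [mC] at h
      exact ⟨h.1, h.2, h'⟩
    have pE₀ : ∀ i ∈ E₀, i ∉ L ∧ i ∉ W ∧ (∀ b ∈ B, x b < x i) ∧ ∀ a ∈ A, y a < y i := by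
      intro i hi
      obtain ⟨h, h'⟩ := Finset.mem_filter.1 hi
      rw [mE] at h
      exact ⟨h.1, h.2, fun b hb => neg_lt_neg_iff.1 (h'.1 b hb),
        fun a ha => neg_lt_neg_iff.1 (h'.2 a ha)⟩
    have pE₂ : ∀ i ∈ E₂, i ∉ L ∧ i ∉ W ∧ (∀ b ∈ B, x i < x b) ∧ ∀ a ∈ A, y i < y a := by
      intro i hi
      obtain ⟨h, h'⟩ := Finset.mem_filter.1 hi
      rw [mE] at h
      exact ⟨h.1, h.2, fun b hb => neg_lt_neg_iff.1 (h'.1 b hb),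
        fun a ha => neg_lt_neg_iff.1 (h'.2 a ha)⟩
    -- The sets are listed from left to right, with the line between `C₂` and `E₂`; from bottom to
    -- top the order is `C₀`, `B`, `C₂`, `E₂`, `A`, `E₀`.
    refine coverable_of_separated hc ![C₀, A, C₂, E₂, B, E₀] ?_ ?_ ?_ ?_
    · intro k l hkl i hi j hj
      fin_cases k <;> fin_cases l <;> simp at hkl hi hj ⊢
      · exact (pC₀ i hi).2.2.1 j hj
      · exact ((pC₀ i hi).2.2.1 a₀ ha₀).trans ((pC₂ j hj).2.2.1 a₀ ha₀)
      · exact hLx i (pC₀ i hi).1 j (pE₂ j hj).1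
      · exact hLx i (pC₀ i hi).1 j (pB j hj).1
      · exact hLx i (pC₀ i hi).1 j (pE₀ j hj).1
      · exact (pC₂ j hj).2.2.1 i hi
      · exact hLx i (pA i hi).1 j (pE₂ j hj).1
      · exact hLx i (pA i hi).1 j (pB j hj).1
      · exact hLx i (pA i hi).1 j (pE₀ j hj).1
      · exact hLx i (pC₂ i hi).1 j (pE₂ j hj).1
      · exact hLx i (pC₂ i hi).1 j (pB j hj).1
      · exact hLx i (pC₂ i hi).1 j (pE₀ j hj).1
      · exact (pE₂ i hi).2.2.1 j hj
      · exact ((pE₂ i hi).2.2.1 b₀ hb₀).trans ((pE₀ j hj).2.2.1 b₀ hb₀)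
      · exact (pE₀ j hj).2.2.1 i hi
    · intro k l hkl
      fin_cases k <;> fin_cases l <;> simp at hkl ⊢
      · exact Or.inl fun i hi j hj => hWy i (pC₀ i hi).2.1 j (pA j hj).2
      · exact Or.inl fun i hi j hj => ((pC₀ i hi).2.2.2 b₀ hb₀).trans ((pC₂ j hj).2.2.2 b₀ hb₀)
      · exact Or.inl fun i hi j hj => hWy i (pC₀ i hi).2.1 j (pE₂ j hj).2.1
      · exact Or.inl fun i hi j hj => (pC₀ i hi).2.2.2 j hj
      · exact Or.inl fun i hi j hj => hWy i (pC₀ i hi).2.1 j (pE₀ j hj).2.1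
      · exact Or.inr fun i hi j hj => hWy j (pC₂ j hj).2.1 i (pA i hi).2
      · exact Or.inr fun i hi j hj => (pE₂ j hj).2.2.2 i hi
      · exact Or.inr fun i hi j hj => hWy j (pB j hj).2 i (pA i hi).2
      · exact Or.inl fun i hi j hj => (pE₀ j hj).2.2.2 i hi
      · exact Or.inl fun i hi j hj => hWy i (pC₂ i hi).2.1 j (pE₂ j hj).2.1
      · exact Or.inr fun i hi j hj => (pC₂ i hi).2.2.2 j hj
      · exact Or.inl fun i hi j hj => hWy i (pC₂ i hi).2.1 j (pE₀ j hj).2.1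
      · exact Or.inr fun i hi j hj => hWy j (pB j hj).2 i (pE₂ i hi).2.1
      · exact Or.inl fun i hi j hj => ((pE₂ i hi).2.2.2 a₀ ha₀).trans ((pE₀ j hj).2.2.2 a₀ ha₀)
      · exact Or.inl fun i hi j hj => hWy i (pB i hi).2 j (pE₀ j hj).2.1
    · intro k
      fin_cases k <;> simp
      · exact Or.inl fun i hi => (hL i).1 (pC₀ i hi).1
      · exact Or.inl fun i hi => (hL i).1 (pA i hi).1
      · exact Or.inl fun i hi => (hL i).1 (pC₂ i hi).1
      · exact Or.inr fun i hi => hL' i (pE₂ i hi).1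
      · exact Or.inr fun i hi => hL' i (pB i hi).1
      · exact Or.inr fun i hi => hL' i (pE₀ i hi).1
    · refine (Set.ncard_le_ncard (t := ((_ ∪ _ : Finset (Fin n)) : Set (Fin n))) ?_
        (Set.toFinite _)).trans ((Set.ncard_coe_finset _).trans_le
          ((Finset.card_union_le _ _).trans ((add_le_add kC kE).trans (by norm_num))))
      intro i hi
      have h0 : i ∉ C₀ := hi 0
      have h1 : i ∉ A := hi 1
      have h2 : i ∉ C₂ := hi 2
      have h3 : i ∉ E₂ := hi 3
      have h4 : i ∉ B := hi 4
      have h5 : i ∉ E₀ := hi 5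
      rw [mA] at h1
      rw [mB] at h4
      have hCE : i ∈ C ∨ i ∈ E := by
        rw [mC, mE]
        tauto
      simp only [Finset.coe_union, Set.mem_union, Finset.mem_coe, Finset.mem_filter]
      rcases hCE with h | h
      · exact Or.inl ⟨h, fun ho => h0 (Finset.mem_filter.2 ⟨h, ho⟩),
          fun ho => h2 (Finset.mem_filter.2 ⟨h, ho⟩)⟩
      · exact Or.inr ⟨h, fun ho => h5 (Finset.mem_filter.2 ⟨h, ho⟩),
          fun ho => h3 (Finset.mem_filter.2 ⟨h, ho⟩)⟩

end PermClass

/-! ### From slow growth to failure of richness, and the skew case -/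

namespace PermClass

theorem xi_pow_le_speed_of_rich {α : Type*} {x y : α → ℝ} (h : Rich x y) {C : Set FinPerm}
    (hC : IsSumClosed C)
    (hsub : ∀ (n : ℕ) (σ : Equiv.Perm (Fin n)), HasPattern x y σ → (⟨n, σ⟩ : FinPerm) ∈ C) (n : ℕ) :
    xi ^ n ≤ xi ^ 8 * speed C n := by
  -- Richness speaks only of lengths 2 to 8; a single point supplies the indecomposable of length 1.
  obtain ⟨a⟩ : Nonempty α := by
    have h2 : 0 < _ := h 2 le_rfl (by norm_num)
    obtain ⟨σ, -, f, -⟩ := (Nat.card_pos_iff.1 h2).1.some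
    exact ⟨f 0⟩
  refine xi_pow_le_speed hC ?_ ?_ (fun n h2 h8 => ?_) n
  · refine Nat.card_pos_iff.2 ⟨⟨⟨1, hsub 0 1 ⟨fun _ => a, ?_, ?_⟩⟩⟩, inferInstance⟩
    · intro i; exact i.elim0
    · intro i; exact i.elim0
  · refine Nat.card_pos_iff.2 ⟨⟨⟨1, hsub 1 1 ⟨fun _ => a, ?_, ?_⟩, ?_⟩⟩, inferInstance⟩
    · exact Subsingleton.strictMono _
    · intro i j
      simp [Subsingleton.elim i j]
    · intro k hk hk1
      change k < 1 at hk1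
      omega
  · refine (h n h2 h8).trans ?_
    exact Nat.card_le_card_of_injective
      (fun σ => (⟨σ.1, hsub n σ.1 σ.2.2, σ.2.1⟩ :
        {σ : Equiv.Perm (Fin n) // (⟨n, σ⟩ : FinPerm) ∈ indecs C}))
      fun σ τ e => Subtype.ext (Subtype.mk.inj e)

/-- The complement of a permutation: its plot is reflected in a horizontal line. -/
def compl (π : FinPerm) : FinPerm := ⟨π.1, π.2.trans Fin.revPerm⟩

theorem compl_sum (π σ : FinPerm) : compl (sum π σ) = skewSum (compl π) (compl σ) := by
  refine Sigma.ext rfl (heq_of_eq (Equiv.ext fun i => ?_))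
  change Fin (π.1 + σ.1) at i
  change Fin.rev (((finSumFinEquiv.symm.trans (Equiv.sumCongr π.2 σ.2)).trans finSumFinEquiv) i) =
    ((((finSumFinEquiv.symm.trans (Equiv.sumCongr (π.2.trans Fin.revPerm)
      (σ.2.trans Fin.revPerm))).trans (Equiv.sumComm _ _)).trans
      finSumFinEquiv).trans (finCongr (Nat.add_comm σ.1 π.1))) i
  apply Fin.ext
  induction i using Fin.addCases with
  | left i =>
    simp only [Equiv.trans_apply, finSumFinEquiv_symm_apply_castAdd, Equiv.sumCongr_apply,
      Sum.map_inl, finSumFinEquiv_apply_left, Equiv.sumComm_apply, Sum.swap_inl,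
      finSumFinEquiv_apply_right, Fin.revPerm_apply, finCongr_apply, Fin.val_cast,
      Fin.val_natAdd, Fin.val_rev, Fin.val_castAdd]
    omega
  | right i =>
    simp only [Equiv.trans_apply, finSumFinEquiv_symm_apply_natAdd, Equiv.sumCongr_apply,
      Sum.map_inr, finSumFinEquiv_apply_left, Equiv.sumComm_apply, Sum.swap_inr,
      finSumFinEquiv_apply_right, Fin.revPerm_apply, finCongr_apply, Fin.val_cast,
      Fin.val_natAdd, Fin.val_rev, Fin.val_castAdd]
    omega

theorem speed_preimage_compl (C : Set FinPerm) (n : ℕ) : speed (compl ⁻¹' C) n = speed C n := by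
  refine Nat.card_congr ⟨fun σ => ⟨σ.1.trans Fin.revPerm, σ.2⟩,
    fun σ => ⟨σ.1.trans Fin.revPerm, ?_⟩, fun σ => ?_, fun σ => ?_⟩
  · have : (σ.1.trans Fin.revPerm).trans Fin.revPerm = σ.1 := by ext i; simp
    change (⟨n, (σ.1.trans Fin.revPerm).trans Fin.revPerm⟩ : FinPerm) ∈ C
    rw [this]
    exact σ.2
  · ext i; simp
  · ext i; simp

theorem isSumClosed_sumClosure (C : Set FinPerm) : IsSumClosed (sumClosure C) :=
  fun π hπ σ hσ D hD => hD.2.1 π (hπ D hD) σ (hσ D hD)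

theorem isSkewClosed_skewClosure (C : Set FinPerm) : IsSkewClosed (skewClosure C) :=
  fun π hπ σ hσ D hD => hD.2.1 π (hπ D hD) σ (hσ D hD)

theorem subset_sumClosure (C : Set FinPerm) : C ⊆ sumClosure C := fun _ h _ hD => hD.2.2 h

theorem subset_skewClosure (C : Set FinPerm) : C ⊆ skewClosure C := fun _ h _ hD => hD.2.2 h

theorem not_rich_of_sum {π : FinPerm} {g : ℝ} (hg : g < xi)
    (h : HasGrowthRate (sumClosure (Sub π)) g) :
    ¬ Rich (fun i : Fin π.1 => ((i : ℕ) : ℝ)) (fun i => ((π.2 i : ℕ) : ℝ)) := by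
  intro hr
  refine absurd (xi_le_growthRate h (xi_pow_le_speed_of_rich hr (isSumClosed_sumClosure _) ?_))
    (not_le.2 hg)
  rintro n σ ⟨f, hf, hσ⟩
  refine subset_sumClosure _ ⟨OrderEmbedding.ofStrictMono f fun i j hij => ?_, fun i j => ?_⟩
  · exact Fin.lt_def.2 (Nat.cast_lt.1 (hf hij))
  · rw [hσ i j, Nat.cast_lt]
    rfl

/-- Complementation turns skew sums into sums, so the preimage of the skew closure under `compl` is
sum closed with the same speed, and the sum argument applies to the reflected plot. -/
theorem not_rich_of_skew {π : FinPerm} {g : ℝ} (hg : g < xi)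
    (h : HasGrowthRate (skewClosure (Sub π)) g) :
    ¬ Rich (fun i : Fin π.1 => ((i : ℕ) : ℝ))
      (fun i => (((π.2.trans Fin.revPerm) i : ℕ) : ℝ)) := by
  intro hr
  have hg' : HasGrowthRate (compl ⁻¹' skewClosure (Sub π)) g := by
    simpa only [HasGrowthRate, speed_preimage_compl] using h
  refine absurd (xi_le_growthRate hg' (xi_pow_le_speed_of_rich hr ?_ ?_)) (not_le.2 hg)
  · intro τ hτ ρ hρ
    rw [Set.mem_preimage, compl_sum]
    exact isSkewClosed_skewClosure _ _ hτ _ hρ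
  rintro n σ ⟨f, hf, hσ⟩
  refine subset_skewClosure _ ⟨OrderEmbedding.ofStrictMono f fun i j hij => ?_, fun i j => ?_⟩
  · exact Fin.lt_def.2 (Nat.cast_lt.1 (hf hij))
  · have e : (compl ⟨n, σ⟩).2 i < (compl ⟨n, σ⟩).2 j ↔ σ j < σ i := Fin.rev_lt_rev
    rw [e, hσ j i, Nat.cast_lt]
    exact Fin.lt_def.symm.trans Fin.rev_lt_rev

theorem isConcentratedPerm_of_coverable {π : FinPerm} {q r : ℕ}
    (hv : ∀ c : ℝ, (∀ i : Fin π.1, ((i : ℕ) : ℝ) ≠ c) →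
      Coverable (fun i : Fin π.1 => ((i : ℕ) : ℝ)) (fun i => ((π.2 i : ℕ) : ℝ)) c q r)
    (hh : ∀ c : ℝ, (∀ i : Fin π.1, ((π.2 i : ℕ) : ℝ) ≠ c) →
      Coverable (fun i => ((π.2 i : ℕ) : ℝ)) (fun i : Fin π.1 => ((i : ℕ) : ℝ)) c q r) :
    IsConcentratedPerm q r π := by
  have img : ∀ a b a' b' : ℝ, a < b → a' < b' →
      Prod.fst '' (Set.Icc a b ×ˢ Set.Icc a' b') = Set.Icc a b ∧
      Prod.snd '' (Set.Icc a b ×ˢ Set.Icc a' b') = Set.Icc a' b' := fun a b a' b' h h' =>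
    ⟨Set.fst_image_prod _ (Set.nonempty_Icc.2 h'.le), Set.snd_image_prod (Set.nonempty_Icc.2 h.le) _⟩
  have dis : ∀ a b a' b' : ℝ, b < a' ∨ b' < a → Disjoint (Set.Icc a b) (Set.Icc a' b') := by
    intro a b a' b' h
    rw [Set.disjoint_left]
    rintro t ⟨h1, h2⟩ ⟨h3, h4⟩
    rcases h with h | h <;> linarith
  rintro L ⟨c, rfl | rfl⟩ hL
  · obtain ⟨a, b, a', b', h1, h2, h3, h4, h5, h6⟩ := hv c fun i hi => hL i hi
    refine ⟨fun k => Set.Icc (a k) (b k) ×ˢ Set.Icc (a' k) (b' k),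
      fun k => ⟨_, _, _, _, h1 k, h2 k, rfl⟩, fun k l hkl => ?_, fun k => ?_, ?_⟩
    · simp only [Independent]
      rw [(img _ _ _ _ (h1 k) (h2 k)).1, (img _ _ _ _ (h1 l) (h2 l)).1,
        (img _ _ _ _ (h1 k) (h2 k)).2, (img _ _ _ _ (h1 l) (h2 l)).2]
      exact ⟨dis _ _ _ _ (h3 k l hkl), dis _ _ _ _ (h4 k l hkl)⟩
    · rw [Set.disjoint_left]
      rintro p ⟨⟨k1, k2⟩, -⟩ hp
      rw [Set.mem_ofPred_eq] at hp
      rcases h5 k with h | h <;> linarith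
    · convert h6 using 4 with i
      simp only [point, Set.mem_prod, Set.mem_Icc, and_assoc]
  · obtain ⟨a, b, a', b', h1, h2, h3, h4, h5, h6⟩ := hh c fun i hi => hL i hi
    refine ⟨fun k => Set.Icc (a' k) (b' k) ×ˢ Set.Icc (a k) (b k),
      fun k => ⟨_, _, _, _, h2 k, h1 k, rfl⟩, fun k l hkl => ?_, fun k => ?_, ?_⟩
    · simp only [Independent]
      rw [(img _ _ _ _ (h2 k) (h1 k)).1, (img _ _ _ _ (h2 l) (h1 l)).1,
        (img _ _ _ _ (h2 k) (h1 k)).2, (img _ _ _ _ (h2 l) (h1 l)).2]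
      exact ⟨dis _ _ _ _ (h4 k l hkl), dis _ _ _ _ (h3 k l hkl)⟩
    · rw [Set.disjoint_left]
      rintro p ⟨-, ⟨k1, k2⟩⟩ hp
      rw [Set.mem_ofPred_eq] at hp
      rcases h5 k with h | h <;> linarith
    · convert h6 using 4 with i
      refine forall_congr' fun k => not_congr ?_
      simp only [point, Set.mem_prod, Set.mem_Icc]
      tauto

end PermClass

theorem mainTheorem3 : PermClass.IsConcentrated (PermClass.cellClass PermClass.xi) := by
  open PermClass in
  refine ⟨6, 198, fun π hπ => ?_⟩
  rcases hπ with ⟨g, hg, h⟩ | ⟨g, hg, h⟩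
  · have hr := not_rich_of_sum hg h
    exact isConcentratedPerm_of_coverable
      (fun c hc => coverable_of_not_rich (Equiv.refl _) π.2 hc hr)
      (fun c hc => coverable_of_not_rich π.2 (Equiv.refl _) hc fun h' => hr h'.transpose)
  · have hr := not_rich_of_skew hg h
    have e : ∀ i : Fin π.1, (((π.2.trans Fin.revPerm) i : ℕ) : ℝ) =
        ((π.1 : ℝ) - 1) - ((π.2 i : ℕ) : ℝ) := by
      intro i
      rw [Equiv.trans_apply, Fin.revPerm_apply, Fin.val_rev, Nat.cast_sub (by omega)]
      push_cast
      ring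
    -- The complement is covered, and the rectangles are reflected back by `t ↦ π.1 - 1 - t`; for
    -- horizontal lines the position of the line is reflected too.
    refine isConcentratedPerm_of_coverable (fun c hc => ?_) (fun c hc => ?_)
    · refine Coverable.reflect_y (s := (π.1 : ℝ) - 1) ?_
      simp only [← e]
      exact coverable_of_not_rich (Equiv.refl _) (π.2.trans Fin.revPerm) hc hr
    · refine Coverable.reflect_x (s := (π.1 : ℝ) - 1) ?_
      simp only [← e]
      refine coverable_of_not_rich (π.2.trans Fin.revPerm) (Equiv.refl _) (fun i hi => ?_)
        fun h' => hr h'.transpose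
      rw [e] at hi
      exact hc i (by linarith)
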